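/- Let $n,m,p\ge 1$, $1\le K\le m\wedge p$, $\sigma>0$, $\alpha\in(0,1)$, $a>0$, $B>0$ and $M_0\in\mathbb R^{m\times p}$. **Model.** For a matrix $M\in\mathbb R^{m\times p}$ let $P_M$ be the law of $X=((i,j),M_{i,j}+\xi)$, where $(i,j)$ is uniform on $\{1,\dots,m\}\times\{1,\dots,p\}$ and $\xi\sim\mathcal N(0,\sigma^2)$ is independent of $(i,j)$. We observe $X_1^n=(X_1,\dots,X_n)$ i.i.d. from $P_{M_0}$. Let $L_n(M)=\prod_{k=1}^n p_M(X_k)$ be the likelihood, $p_M$ being the density of $P_M$ with respect to counting measure times Lebesgue measure. Put $d_{\alpha,\sigma}(M,N)=D_\alpha(P_M,P_N)$, where $D_\alpha(P,R)=\frac1{\alpha-1}\log\int (dP/d\mu)^\alpha(dR/d\mu)^{1-\alpha}d\mu$ is the Rényi divergence ($\mu$ any measure dominating $P$ and $R$). **Prior and variational approximation.** For $b>0$, let $\pi$ be the prior on $(U,V,\gamma)\in\mathbb R^{m\times K}\times\mathbb R^{p\times K}\times\mathbb R^K$ under which the $\gamma_k$ are independent with $1/\gamma_k\sim\Gamma(a,b)$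 (shape $a$, rate $b$) and, given $\gamma$, the entries $U_{i,k}$ and $V_{j,k}$ are independent $\mathcal N(0,\gamma_k)$. The tempered posterior is $\pi_{n,\alpha}(d(U,V,\gamma)|X_1^n)\propto L_n(UV^t)^\alpha\,\pi(d(U,V,\gamma))$. Let $\mathcal F$ be the mean-field family of all probability measures $\bigotimes_{i=1}^m\rho_{U_i}(dU_{i,\cdot})\otimes\bigotimes_{j=1}^p\rho_{V_j}(dV_{j,\cdot})\otimes\bigotimes_{k=1}^K\rho_{\gamma_k}(d\gamma_k)$, and let $\tilde\pi_{n,\alpha}(\cdot|X_1^n)$ be any minimiser over $\rho\in\mathcal F$, chosen measurably in $X_1^n$, of the Kullback–Leibler divergence $\mathcal K(\rho,\pi_{n,\alpha}(\cdot|X_1^n))$. We also write $\tilde\pi_{n,\alpha}(dM|X_1^n)$ for the law of $M=UV^t$ under it. For $1\le r\le K$ let $\mathcal M(r,B)$ be the set of pairs $(\bar U,\bar V)\in\mathbb R^{m\times K}\times\mathbb R^{p\times K}$ with all entries in $[-B,B]$ and with $\bar U_{i,\ell}=0$ and $\bar V_{j,\ell}=0$ for all $\ell>r$. **Theorem.**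 There is a small enough $b>0$, namely $b=B^2/\{512(nmp)^4[(m\vee p)K]^2\}$ (which depends on neither $\alpha$, $\sigma$, $a$ nor $M_0$), such that $$\mathbb E\left[\int d_{\alpha,\sigma}(M,M_0)\,\tilde\pi_{n,\alpha}(dM|X_1^n)\right]\le\inf_{1\le r\le K}\ \inf_{(\bar U,\bar V)\in\mathcal M(r,B)}\left\{\frac{\alpha}{1-\alpha}\,\frac{\left[\|M_0-\bar U\bar V^t\|_F+\varepsilon\right]^2}{2\sigma^2mp}+\frac{2(1+\alpha)(1+2a)\,r(m+p)\left[\log(nmp)+\mathcal C(a)\right]}{n(1-\alpha)}\right\},$$ where $\|\cdot\|_F$ is the Frobenius norm, $\mathcal C(a)=\log\left(8\sqrt\pi\,\Gamma(a)\,2^{10a+1}\right)+3$ and $$\varepsilon=\max\left(\frac{\sqrt B}{n},\ \frac{B^2}{n^2mp}\right),$$ so that $\varepsilon=\sqrt B/n$ whenever $B^{3/2}\le nmp$. -/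

import Mathlib

open MeasureTheory ProbabilityTheory
open scoped ENNReal

noncomputable section

namespace MatrixVB

/-! ### Divergences -/

/-- The `α`-Rényi divergence
`D_α(P, R) = (α - 1)⁻¹ log ∫ (dP/dμ)^α (dR/dμ)^(1-α) dμ` with `μ = P + R`, as an extended real
(`+∞` when `P` and `R` are mutually singular). -/
def renyiDiv {E : Type*} [MeasurableSpace E] (α : ℝ) (P R : Measure E) : EReal :=
  (((α - 1)⁻¹ : ℝ) : EReal) *
    ENNReal.log (∫⁻ x, (P.rnDeriv (P + R) x) ^ α * (R.rnDeriv (P + R) x) ^ (1 - α) ∂(P + R))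

/-! ### The observation model -/

/-- One observation: the revealed position `(i, j)` and the noisy value of that entry. -/
abbrev Obs (m p : ℕ) : Type := (Fin m × Fin p) × ℝ

/-- The law `P_M` of one observation: `(i, j)` is uniform, `ξ ~ N(0, σ²)` is independent of it,
and the observation is `((i, j), M i j + ξ)`. -/
def obsLaw {m p : ℕ} (σ : ℝ) (M : Matrix (Fin m) (Fin p) ℝ) : Measure (Obs m p) :=
  ((uniformOn (Set.univ : Set (Fin m × Fin p))).prod (gaussianReal 0 (σ ^ 2).toNNReal)).map
    fun ω => (ω.1, M ω.1.1 ω.1.2 + ω.2)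

/-- The law of the sample of `n` i.i.d. observations from `P_M`. -/
def sampleLaw {m p : ℕ} (n : ℕ) (σ : ℝ) (M : Matrix (Fin m) (Fin p) ℝ) :
    Measure (Fin n → Obs m p) :=
  Measure.pi fun _ => obsLaw σ M

/-- The density of `P_M` with respect to counting measure times Lebesgue measure. -/
def obsDensity {m p : ℕ} (σ : ℝ) (M : Matrix (Fin m) (Fin p) ℝ) (x : Obs m p) : ℝ :=
  ((m : ℝ) * (p : ℝ))⁻¹ * gaussianPDFReal (M x.1.1 x.1.2) (σ ^ 2).toNNReal x.2

/-- The likelihood `L_n(M)` of a sample. -/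
def likelihood {m p n : ℕ} (σ : ℝ) (x : Fin n → Obs m p) (M : Matrix (Fin m) (Fin p) ℝ) : ℝ :=
  ∏ k, obsDensity σ M (x k)

/-- `d_{α,σ}(M, N) = D_α(P_M, P_N)`; it is nonnegative for `0 < α < 1`. -/
def dist {m p : ℕ} (α σ : ℝ) (M N : Matrix (Fin m) (Fin p) ℝ) : ℝ≥0∞ :=
  (renyiDiv α (obsLaw σ M) (obsLaw σ N)).toENNReal

/-! ### Prior, tempered posterior and mean-field approximation -/

/-- The parameter `θ = (U, V, γ)`. -/
abbrev Param (m p K : ℕ) : Type :=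
  (Fin m → Fin K → ℝ) × (Fin p → Fin K → ℝ) × (Fin K → ℝ)

/-- The matrix `M = U Vᵗ` that belongs to the parameter `(U, V, γ)`. -/
def Param.toMatrix {m p K : ℕ} (θ : Param m p K) : Matrix (Fin m) (Fin p) ℝ :=
  Matrix.of θ.1 * (Matrix.of θ.2.1).transpose

/-- The inverse-gamma distribution: the law of `γ` when `1/γ ~ Γ(a, b)` (shape `a`, rate `b`). -/
def invGammaMeasure (a b : ℝ) : Measure ℝ :=
  (gammaMeasure a b).map fun x => x⁻¹

/-- The prior on `(U, V, γ)`: the `γ k` are independent with `1/γ k ~ Γ(a, b)` and, given `γ`, the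
entries `U i k` and `V j k` are independent `N(0, γ k)`, that is, `√(γ k)` times independent
standard Gaussian variables. -/
def prior (m p K : ℕ) (a b : ℝ) : Measure (Param m p K) :=
  ((Measure.pi fun _ : Fin m => Measure.pi fun _ : Fin K => gaussianReal 0 1).prod
    ((Measure.pi fun _ : Fin p => Measure.pi fun _ : Fin K => gaussianReal 0 1).prod
      (Measure.pi fun _ : Fin K => invGammaMeasure a b))).map
    fun ω => (fun i k => √(ω.2.2 k) * ω.1 i k, fun j k => √(ω.2.2 k) * ω.2.1 j k, ω.2.2)

/-- The tempered posterior `π_{n,α}(dθ | x) ∝ L_n(θ)^α π(dθ)`. -/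
def temperedPosterior {m p K n : ℕ} (α σ a b : ℝ) (x : Fin n → Obs m p) :
    Measure (Param m p K) :=
  (∫⁻ θ, ENNReal.ofReal (likelihood σ x θ.toMatrix ^ α) ∂(prior m p K a b))⁻¹ •
    (prior m p K a b).withDensity fun θ => ENNReal.ofReal (likelihood σ x θ.toMatrix ^ α)

/-- The mean-field family: under `ρ` the rows of `U`, the rows of `V` and the coordinates of `γ`
are all independent. -/
def meanField (m p K : ℕ) : Set (Measure (Param m p K)) :=
  {ρ | ∃ (ρU : Fin m → ProbabilityMeasure (Fin K → ℝ))
      (ρV : Fin p → ProbabilityMeasure (Fin K → ℝ)) (ργ : Fin K → ProbabilityMeasure ℝ),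
      ρ = (Measure.pi fun i => (ρU i : Measure (Fin K → ℝ))).prod
        ((Measure.pi fun j => (ρV j : Measure (Fin K → ℝ))).prod
          (Measure.pi fun k => (ργ k : Measure ℝ)))}

/-- `ρ` is a variational approximation of the tempered posterior: a minimiser over the mean-field
family of the Kullback-Leibler divergence `K(ρ, π_{n,α}(· | x))`. -/
def IsVBApprox {m p K n : ℕ} (α σ a b : ℝ) (x : Fin n → Obs m p) (ρ : Measure (Param m p K)) :
    Prop :=
  ρ ∈ meanField m p K ∧
    IsMinOn (fun ρ' => InformationTheory.klDiv ρ' (temperedPosterior α σ a b x))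
      (meanField m p K) ρ

/-! ### Ingredients of the bound -/

section
open scoped Matrix.Norms.Frobenius

/-- The Frobenius norm. -/
def frobNorm {m p : ℕ} (A : Matrix (Fin m) (Fin p) ℝ) : ℝ := ‖A‖

end

/-- The set `M(r, B)`: pairs of an `m × K` and a `p × K` matrix whose entries are bounded by `B`
and whose columns after the first `r` vanish. -/
def factorPairs (m p K r : ℕ) (B : ℝ) :
    Set (Matrix (Fin m) (Fin K) ℝ × Matrix (Fin p) (Fin K) ℝ) :=
  {W | (∀ i l, |W.1 i l| ≤ B) ∧ (∀ j l, |W.2 j l| ≤ B) ∧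
    (∀ i (l : Fin K), r ≤ (l : ℕ) → W.1 i l = 0) ∧ (∀ j (l : Fin K), r ≤ (l : ℕ) → W.2 j l = 0)}

/-- The constant `C(a) = log (8 √π Γ(a) 2^(10 a + 1)) + 3`. -/
def constC (a : ℝ) : ℝ :=
  Real.log (8 * √Real.pi * Real.Gamma a * (2 : ℝ) ^ (10 * a + 1)) + 3

end MatrixVB

end

namespace MatrixVB

/-! ### Product densities, variational inequalities for the Kullback–Leibler divergence, Gaussian
second moments. -/

section Generic

open InformationTheory

/-! Write `N` for the true matrix `M₀`. For a fixed `M`, independence gives E[(L_n(M)/L_n(N))^α] =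
A(M,N)^n = exp(-n(1-α) d(M,N)), where A is the `affinity`. By Tonelli the random variable w = ∫
exp(n(1-α)d(M,N)) (L_n(M)/L_n(N))^α dπ (`expMoment`) therefore has mean at most one
(`lintegral_expMoment_le`). No testing or entropy condition is needed; this is where α < 1 pays.

The Donsker–Varadhan inequality (`lintegral_le_klDiv_add_log`), applied to the variational
approximation ρ' and the tempered posterior P, bounds n(1-α)∫d dρ' by K(ρ',P) + log ∫exp(n(1-α)d)dP.
Minimality of ρ' allows K(ρ',P) to be replaced by K(ρ,P) for any ρ of the mean-field family. The two
normalising constants cancel, which leaves K(ρ,π) + α∫log(L_n(N)/L_n(M))dρ + log w. Since log w ≤ w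
- 1 has nonpositive mean, taking expectations gives the oracle inequality `vb_expected_risk_le`.

It remains to choose ρ. Rows of U and V are Gaussian, centred at Ū and V̄ with diagonal covariance,
and each γ_k follows its prior conditioned on an interval (`gaussianProduct`). The expected
log-likelihood ratio is then n/(2σ²mp) times the squared Frobenius bias plus the total variance of
UVᵗ. On the r active columns the variance is tiny and γ_k is of order B²; each of the m+p entries
costs a logarithm of a power of nmp. On the other columns the law is N(0,b), with γ_k confined so
close to b that a whole column costs only O(log(m+p)) up to a constant depending on a; the sum over
at most K ≤ (m+p)/2 such columns is of the order of the active cost. Smallness of b makes these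
columns harmless for UVᵗ, while its polynomial size keeps the prior mass of the active γ_k only
polynomially small (`exists_good_meanField`). -/

theorem lintegral_pi_prod {ι : Type*} [Fintype ι] {Ω : ι → Type*} [∀ i, MeasurableSpace (Ω i)]
    (μ : ∀ i, Measure (Ω i)) [∀ i, IsProbabilityMeasure (μ i)] (f : ∀ i, Ω i → ℝ≥0∞)
    (hf : ∀ i, Measurable (f i)) :
    ∫⁻ x, ∏ i, f i (x i) ∂(Measure.pi μ) = ∏ i, ∫⁻ y, f i y ∂(μ i) := by
  rw [lintegral_prod_eq_prod_lintegral_of_indepFun Finset.univ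
    (fun i (x : ∀ i, Ω i) => f i (x i)) (iIndepFun_pi fun i => (hf i).aemeasurable)
    (fun i => (hf i).comp (measurable_pi_apply i))]
  refine Finset.prod_congr rfl fun i _ => ?_
  exact (measurePreserving_eval μ i).lintegral_comp (hf i)

theorem pi_withDensity {ι : Type*} [Fintype ι] {Ω : ι → Type*} [∀ i, MeasurableSpace (Ω i)]
    (μ ν : ∀ i, Measure (Ω i)) [∀ i, IsProbabilityMeasure (μ i)] [∀ i, IsProbabilityMeasure (ν i)]
    (f : ∀ i, Ω i → ℝ≥0∞) (hf : ∀ i, Measurable (f i)) (hν : ∀ i, ν i = (μ i).withDensity (f i)) :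
    Measure.pi ν = (Measure.pi μ).withDensity fun x => ∏ i, f i (x i) := by
  refine Measure.pi_eq fun s hs => ?_
  rw [withDensity_apply _ (MeasurableSet.univ_pi hs),
    ← lintegral_indicator (MeasurableSet.univ_pi hs)]
  have : (Set.univ.pi s).indicator (fun x : ∀ i, Ω i => ∏ i, f i (x i)) =
      fun x => ∏ i, (s i).indicator (f i) (x i) := by
    funext x
    by_cases hx : x ∈ Set.univ.pi s
    · rw [Set.indicator_of_mem hx]
      exact Finset.prod_congr rfl fun i _ => by
        rw [Set.indicator_of_mem (hx i (Set.mem_univ i))]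
    · rw [Set.indicator_of_notMem hx]
      simp only [Set.mem_univ_pi, not_forall] at hx
      obtain ⟨i, hi⟩ := hx
      exact (Finset.prod_eq_zero (Finset.mem_univ i) (Set.indicator_of_notMem hi _)).symm
  rw [this, lintegral_pi_prod _ _ fun i => (hf i).indicator (hs i)]
  refine Finset.prod_congr rfl fun i _ => ?_
  rw [lintegral_indicator (hs i), hν i, withDensity_apply _ (hs i)]

/-- Fenchel–Young for the conjugate pair x log x - x and exp; for x > 0 it is exp t ≥ 1 + t at t = y
- log x. -/
theorem mul_le_klFun_add_exp {x : ℝ} (hx : 0 ≤ x) (y : ℝ) :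
    y * x + 1 ≤ klFun x + Real.exp y := by
  rw [klFun_apply]
  rcases hx.eq_or_lt with rfl | hx
  · simp [Real.exp_nonneg]
  · have h1 := Real.add_one_le_exp (y - Real.log x)
    rw [Real.exp_sub, Real.exp_log hx, le_div_iff₀ hx] at h1
    nlinarith

/-- Donsker–Varadhan: Fenchel–Young is integrated with x = dρ/dP and y = f - c, where c = log ∫exp f
dP. Keeping all terms nonnegative removes any need for f to be ρ-integrable. -/
theorem lintegral_le_klDiv_add_log {Θ : Type*} [MeasurableSpace Θ] (ρ P : Measure Θ)
    [IsProbabilityMeasure ρ] [IsProbabilityMeasure P] {f : Θ → ℝ} (hf : Measurable f)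
    (hf0 : ∀ θ, 0 ≤ f θ) (hfin : ∫⁻ θ, ENNReal.ofReal (Real.exp (f θ)) ∂P ≠ ⊤) :
    ∫⁻ θ, ENNReal.ofReal (f θ) ∂ρ ≤ klDiv ρ P +
      ENNReal.ofReal (Real.log (∫⁻ θ, ENNReal.ofReal (Real.exp (f θ)) ∂P).toReal) := by
  by_cases hac : ρ ≪ P
  swap
  · simp [klDiv_of_not_ac hac]
  set E := ∫⁻ θ, ENNReal.ofReal (Real.exp (f θ)) ∂P with hE
  have hE1 : 1 ≤ E := by
    calc (1 : ℝ≥0∞) = ∫⁻ _, 1 ∂P := by simp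
      _ ≤ E := lintegral_mono fun θ => by
        rw [← ENNReal.ofReal_one]
        exact ENNReal.ofReal_le_ofReal (Real.one_le_exp (hf0 θ))
  have hE1' : 1 ≤ E.toReal := by
    simpa using (ENNReal.toReal_le_toReal ENNReal.one_ne_top hfin).2 hE1
  set c := Real.log E.toReal with hc
  have hc0 : 0 ≤ c := Real.log_nonneg hE1'
  -- The terms -c x and 1 are placed on the sides where they are nonnegative. After integration both
  -- sides contain a 1, which cancels.
  have key : ∀ᵐ θ ∂P, ρ.rnDeriv P θ * ENNReal.ofReal (f θ) + 1 ≤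
      ENNReal.ofReal (klFun (ρ.rnDeriv P θ).toReal) +
        (ENNReal.ofReal (Real.exp (f θ)) * ENNReal.ofReal (Real.exp (-c)) +
          ρ.rnDeriv P θ * ENNReal.ofReal c) := by
    filter_upwards [ρ.rnDeriv_ne_top P] with θ hθ
    have h1 := mul_le_klFun_add_exp (x := (ρ.rnDeriv P θ).toReal) ENNReal.toReal_nonneg (f θ - c)
    set x := (ρ.rnDeriv P θ).toReal with hx
    have hx0 : 0 ≤ x := ENNReal.toReal_nonneg
    rw [← ENNReal.ofReal_toReal hθ, ← hx, ← ENNReal.ofReal_mul hx0, ← ENNReal.ofReal_mul hx0,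
      ← ENNReal.ofReal_mul (Real.exp_nonneg _), ← Real.exp_add, ← ENNReal.ofReal_one,
      ← ENNReal.ofReal_add (mul_nonneg hx0 (hf0 θ)) zero_le_one,
      ← ENNReal.ofReal_add (Real.exp_nonneg _) (mul_nonneg hx0 hc0),
      ← ENNReal.ofReal_add (klFun_nonneg hx0) (add_nonneg (Real.exp_nonneg _) (mul_nonneg hx0 hc0))]
    refine ENNReal.ofReal_le_ofReal ?_
    rw [← sub_eq_add_neg]
    linarith
  have h2 := lintegral_mono_ae key
  have hrn : Measurable (ρ.rnDeriv P) := Measure.measurable_rnDeriv _ _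
  rw [lintegral_add_right _ measurable_const, lintegral_rnDeriv_mul hac hf.ennreal_ofReal.aemeasurable,
    lintegral_add_right _ (by fun_prop), lintegral_add_right _ (by fun_prop),
    lintegral_mul_const _ (by fun_prop), ← hE, lintegral_mul_const _ hrn,
    Measure.lintegral_rnDeriv hac, measure_univ, one_mul,
    ← klDiv_eq_lintegral_klFun_of_ac hac, Real.exp_neg, hc, Real.exp_log (by linarith),
    ENNReal.ofReal_inv_of_pos (by linarith), ENNReal.ofReal_toReal hfin,
    ENNReal.mul_inv_cancel (by positivity) hfin] at h2
  simp only [lintegral_const, measure_univ, mul_one] at h2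
  rw [add_comm _ (1 : ℝ≥0∞), add_left_comm] at h2
  exact (ENNReal.add_le_add_iff_left ENNReal.one_ne_top).1 h2

/-- An integrable majorant of the log-density suffices, so the divergence itself is never computed.
Nonnegativity of the integral of the majorant is recorded because bounds will be added under
`ENNReal.ofReal`. -/
theorem klDiv_le_of_log_le {Θ : Type*} [MeasurableSpace Θ] {ρ P : Measure Θ}
    [IsProbabilityMeasure ρ] [IsProbabilityMeasure P] {φ : Θ → ℝ≥0∞} (hφ : Measurable φ)
    (hρ : ρ = P.withDensity φ) {ψ : Θ → ℝ} (hψ : Integrable ψ ρ)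
    (hle : ∀ᵐ θ ∂ρ, Real.log (φ θ).toReal ≤ ψ θ) :
    klDiv ρ P ≤ ENNReal.ofReal (∫ θ, ψ θ ∂ρ) ∧ 0 ≤ ∫ θ, ψ θ ∂ρ := by
  have hac : ρ ≪ P := hρ ▸ withDensity_absolutelyContinuous _ _
  have hone : ∫⁻ θ, φ θ ∂P = 1 := by
    have := measure_univ (μ := ρ)
    rwa [hρ, withDensity_apply _ MeasurableSet.univ, Measure.restrict_univ] at this
  have hfin : ∀ᵐ θ ∂P, φ θ < ⊤ := ae_lt_top hφ (by simp [hone])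
  have hrn : ρ.rnDeriv P =ᵐ[P] φ := by
    rw [hρ]; exact Measure.rnDeriv_withDensity _ hφ
  have hint : Integrable (fun θ => (φ θ).toReal • ψ θ) P := by
    rw [hρ] at hψ
    exact (integrable_withDensity_iff_integrable_smul' hφ hfin).1 hψ
  have hint1 : Integrable (fun θ => (φ θ).toReal) P :=
    integrable_toReal_of_lintegral_ne_top hφ.aemeasurable (by simp [hone])
  have hval : ∫ θ, (φ θ).toReal • ψ θ ∂P = ∫ θ, ψ θ ∂ρ := by
    rw [hρ, integral_withDensity_eq_integral_toReal_smul hφ hfin]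
  have hval1 : ∫ θ, (φ θ).toReal ∂P = 1 := by
    rw [integral_toReal hφ.aemeasurable hfin, hone, ENNReal.toReal_one]
  have hle' : ∀ᵐ θ ∂P, φ θ ≠ 0 → Real.log (φ θ).toReal ≤ ψ θ := by
    rw [hρ] at hle
    exact (ae_withDensity_iff hφ).1 hle
  have hpt : ∀ᵐ θ ∂P, klFun (φ θ).toReal ≤ (φ θ).toReal • ψ θ + 1 - (φ θ).toReal := by
    filter_upwards [hle'] with θ hθ
    rw [klFun_apply, smul_eq_mul]
    by_cases h0 : φ θ = 0
    · simp [h0]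
    · have := mul_le_mul_of_nonneg_left (hθ h0) (ENNReal.toReal_nonneg (a := φ θ))
      linarith
  have hInt : Integrable (fun θ => (φ θ).toReal • ψ θ + 1 - (φ θ).toReal) P :=
    (hint.add (integrable_const 1)).sub hint1
  have hVal : ∫ θ, ((φ θ).toReal • ψ θ + 1 - (φ θ).toReal) ∂P = ∫ θ, ψ θ ∂ρ := by
    have e1 : ∫ θ, ((φ θ).toReal • ψ θ + 1) ∂P = ∫ θ, ψ θ ∂ρ + 1 := by
      rw [integral_add hint (integrable_const 1), hval]
      simp
    have e2 := integral_sub (hint.add (integrable_const (1 : ℝ))) hint1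
    simp only [Pi.add_apply] at e2
    rw [e2, e1, hval1]
    ring
  have hpos : 0 ≤ᵐ[P] fun θ => (φ θ).toReal • ψ θ + 1 - (φ θ).toReal := by
    filter_upwards [hpt] with θ hθ
    exact (klFun_nonneg ENNReal.toReal_nonneg).trans hθ
  constructor
  · rw [klDiv_eq_lintegral_klFun_of_ac hac, ← hVal, ofReal_integral_eq_lintegral_ofReal hInt hpos]
    refine lintegral_mono_ae ?_
    filter_upwards [hrn, hpt] with θ h1 h2
    rw [h1]
    exact ENNReal.ofReal_le_ofReal h2
  · rw [← hVal]
    exact integral_nonneg_of_ae hpos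

theorem memLp_linear_pi_gaussian {K : ℕ} (u : Fin K → ℝ) (s : Fin K → NNReal) (c : ℝ)
    (v : Fin K → ℝ) :
    MemLp (fun x : Fin K → ℝ => c - ∑ k, x k * v k) 2
      (Measure.pi fun k => gaussianReal (u k) (s k)) := by
  refine (memLp_const c).sub (memLp_finsetSum _ fun k _ => ?_)
  exact (((memLp_id_gaussianReal 2).mul_const (v k)).comp_measurePreserving
    (measurePreserving_eval (fun k => gaussianReal (u k) (s k)) k))

/-- Squared mean plus variance, the variances adding up by independence. -/
theorem integral_linear_sq_pi_gaussian {K : ℕ} (u : Fin K → ℝ) (s : Fin K → NNReal) (c : ℝ)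
    (v : Fin K → ℝ) :
    ∫ x : Fin K → ℝ, (c - ∑ k, x k * v k) ^ 2 ∂(Measure.pi fun k => gaussianReal (u k) (s k)) =
      (c - ∑ k, u k * v k) ^ 2 + ∑ k, s k * v k ^ 2 := by
  have hX : ∀ k, MemLp (fun y : ℝ => y * v k) 2 (gaussianReal (u k) (s k)) := fun k =>
    (memLp_id_gaussianReal 2).mul_const (v k)
  have h1 := variance_sum_pi hX
  have h2 := variance_eq_sub (memLp_linear_pi_gaussian u s c v)
  have hi : ∀ k, Integrable (fun x : Fin K → ℝ => x k * v k)
      (Measure.pi fun k => gaussianReal (u k) (s k)) := fun k =>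
    integrable_comp_eval (μ := fun k => gaussianReal (u k) (s k)) (i := k)
      (f := fun y => y * v k) ((hX k).integrable (by norm_num))
  have h3 : ∫ x : Fin K → ℝ, (c - ∑ k, x k * v k)
      ∂(Measure.pi fun k => gaussianReal (u k) (s k)) = c - ∑ k, u k * v k := by
    rw [integral_sub (integrable_const _) (integrable_finsetSum _ fun k _ => hi k),
      integral_finsetSum _ fun k _ => hi k]
    simp only [integral_const, probReal_univ, one_smul]
    congr 1
    refine Finset.sum_congr rfl fun k _ => ?_
    rw [integral_comp_eval (μ := fun k => gaussianReal (u k) (s k)) (i := k)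
      (f := fun y => y * v k) (hX k).1, integral_mul_const]
    simp [integral_id_gaussianReal]
  have h4 : Var[fun x : Fin K → ℝ => c - ∑ k, x k * v k;
      Measure.pi fun k => gaussianReal (u k) (s k)] = ∑ k, s k * v k ^ 2 := by
    rw [variance_const_sub]
    · have : (fun x : Fin K → ℝ => ∑ k, x k * v k) =
          ∑ k, fun x : Fin K → ℝ => x k * v k := by
        funext x; simp
      rw [this, h1]
      refine Finset.sum_congr rfl fun k _ => ?_
      rw [variance_mul_const, variance_fun_id_gaussianReal]
    · exact (integrable_finsetSum _ fun k _ => hi k).1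
  rw [h3, h4] at h2
  simp only [Pi.pow_apply] at h2
  linarith

end Generic

end MatrixVB

noncomputable section

namespace MatrixVB

/-! ### The law of one observation, likelihood ratios, and the Rényi divergence as a log-affinity.
-/

section Observation

variable {m p : ℕ}

theorem isProbabilityMeasure_obsLaw (hm : 1 ≤ m) (hp : 1 ≤ p) (σ : ℝ)
    (M : Matrix (Fin m) (Fin p) ℝ) : IsProbabilityMeasure (obsLaw σ M) := by
  have : NeZero m := ⟨by omega⟩
  have : NeZero p := ⟨by omega⟩
  have : IsProbabilityMeasure (uniformOn (Set.univ : Set (Fin m × Fin p))) :=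
    isProbabilityMeasure_uniformOn Set.finite_univ Set.univ_nonempty
  exact Measure.isProbabilityMeasure_map (by fun_prop)

theorem uniformOn_univ_eq (m p : ℕ) :
    uniformOn (Set.univ : Set (Fin m × Fin p)) = ((m * p : ℕ) : ℝ≥0∞)⁻¹ • Measure.count := by
  ext s _
  rw [uniformOn_univ]
  simp [div_eq_mul_inv, mul_comm]

theorem measurable_shift (M : Matrix (Fin m) (Fin p) ℝ) :
    Measurable fun ω : (Fin m × Fin p) × ℝ => (ω.1, M ω.1.1 ω.1.2 + ω.2) := by
  fun_prop

theorem lintegral_obsLaw (σ : ℝ) (M : Matrix (Fin m) (Fin p) ℝ) {f : Obs m p → ℝ≥0∞}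
    (hf : Measurable f) :
    ∫⁻ x, f x ∂(obsLaw σ M) = ((m * p : ℕ) : ℝ≥0∞)⁻¹ *
      ∑ ij : Fin m × Fin p, ∫⁻ y, f (ij, y) ∂(gaussianReal (M ij.1 ij.2) (σ ^ 2).toNNReal) := by
  rw [obsLaw, lintegral_map hf (measurable_shift M), uniformOn_univ_eq,
    lintegral_prod _ (by fun_prop), lintegral_smul_measure, lintegral_count, tsum_fintype,
    smul_eq_mul]
  congr 1
  refine Finset.sum_congr rfl fun ij _ => ?_
  have := gaussianReal_map_const_add (μ := 0) (v := (σ ^ 2).toNNReal) (M ij.1 ij.2)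
  rw [zero_add] at this
  rw [← this, lintegral_map (by fun_prop) (by fun_prop)]

/-- The likelihood ratio `p_M / p_N` of one observation. -/
def obsRatio (σ : ℝ) (M N : Matrix (Fin m) (Fin p) ℝ) (x : Obs m p) : ℝ :=
  Real.exp (((x.2 - N x.1.1 x.1.2) ^ 2 - (x.2 - M x.1.1 x.1.2) ^ 2) / (2 * σ ^ 2))

theorem gaussianPDFReal_eq_mul (σ μ ν y : ℝ) :
    gaussianPDFReal μ (σ ^ 2).toNNReal y =
      Real.exp (((y - ν) ^ 2 - (y - μ) ^ 2) / (2 * σ ^ 2)) *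
        gaussianPDFReal ν (σ ^ 2).toNNReal y := by
  simp only [gaussianPDFReal, Real.coe_toNNReal _ (sq_nonneg σ)]
  rw [mul_left_comm, ← Real.exp_add]
  congr 2
  ring

theorem obsDensity_eq_mul (σ : ℝ) (M N : Matrix (Fin m) (Fin p) ℝ) (x : Obs m p) :
    obsDensity σ M x = obsRatio σ M N x * obsDensity σ N x := by
  rw [obsDensity, obsDensity, gaussianPDFReal_eq_mul σ _ (N x.1.1 x.1.2), obsRatio]
  ring

theorem obsDensity_pos (hm : 1 ≤ m) (hp : 1 ≤ p) {σ : ℝ} (hσ : 0 < σ)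
    (M : Matrix (Fin m) (Fin p) ℝ) (x : Obs m p) : 0 < obsDensity σ M x := by
  have h1 : (0 : ℝ) < m := by exact_mod_cast hm
  have h2 : (0 : ℝ) < p := by exact_mod_cast hp
  refine mul_pos (by positivity) (gaussianPDFReal_pos _ _ _ ?_)
  simpa using hσ.ne'

theorem obsRatio_pos (σ : ℝ) (M N : Matrix (Fin m) (Fin p) ℝ) (x : Obs m p) :
    0 < obsRatio σ M N x := Real.exp_pos _

theorem measurable_entry (M : Matrix (Fin m) (Fin p) ℝ) :
    Measurable fun x : Obs m p => M x.1.1 x.1.2 := by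
  fun_prop

theorem measurable_obsRatio (σ : ℝ) (M N : Matrix (Fin m) (Fin p) ℝ) :
    Measurable (obsRatio σ M N) := by
  unfold obsRatio
  fun_prop

/-- Position by position both laws have Gaussian densities, and the uniform weights 1/(mp) cancel in
the ratio. -/
theorem obsLaw_eq_withDensity {σ : ℝ} (hσ : 0 < σ) (M N : Matrix (Fin m) (Fin p) ℝ) :
    obsLaw σ M = (obsLaw σ N).withDensity fun x => ENNReal.ofReal (obsRatio σ M N x) := by
  have hr : Measurable fun x => ENNReal.ofReal (obsRatio σ M N x) :=
    (measurable_obsRatio σ M N).ennreal_ofReal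
  refine Measure.ext_of_lintegral _ fun f hf => ?_
  rw [lintegral_withDensity_eq_lintegral_mul _ hr hf, lintegral_obsLaw _ _ hf,
    lintegral_obsLaw _ _ (hr.mul hf)]
  congr 1
  refine Finset.sum_congr rfl fun ij _ => ?_
  have hv : (σ ^ 2).toNNReal ≠ 0 := by simpa using hσ.ne'
  have hfy : Measurable fun y => f (ij, y) := hf.comp (by fun_prop)
  have hry : Measurable fun y => ENNReal.ofReal (obsRatio σ M N (ij, y)) := hr.comp (by fun_prop)
  rw [gaussianReal_of_var_ne_zero _ hv, gaussianReal_of_var_ne_zero _ hv,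
    lintegral_withDensity_eq_lintegral_mul _ (measurable_gaussianPDF _ _) hfy]
  simp only [Pi.mul_apply]
  rw [
    lintegral_withDensity_eq_lintegral_mul _ (measurable_gaussianPDF _ _)
      (g := fun y => ENNReal.ofReal (obsRatio σ M N (ij, y)) * f (ij, y)) (hry.mul hfy)]
  refine lintegral_congr fun y => ?_
  simp only [Pi.mul_apply, gaussianPDF]
  rw [gaussianPDFReal_eq_mul σ _ (N ij.1 ij.2), ENNReal.ofReal_mul (Real.exp_nonneg _), obsRatio]
  ring

/-- The `α`-affinity `∫ p_M^α p_N^(1-α)`, written as an expectation under `P_N`. -/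
def affinity (α σ : ℝ) (M N : Matrix (Fin m) (Fin p) ℝ) : ℝ≥0∞ :=
  ∫⁻ x, ENNReal.ofReal (obsRatio σ M N x) ^ α ∂(obsLaw σ N)

/-- With P = gR the dominating measure is (g+1)R, and the two derivatives are g/(g+1) and 1/(g+1).
The powers of g+1 in the integrand multiply to (g+1)⁻¹, which the change of measure back to R
removes. -/
theorem renyiDiv_withDensity {E : Type*} [MeasurableSpace E] (α : ℝ)
    (R : Measure E) [IsFiniteMeasure R] {g : E → ℝ} (hg : Measurable g) (hg0 : ∀ x, 0 < g x)
    (P : Measure E) [IsFiniteMeasure P]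
    (hP : P = R.withDensity fun x => ENNReal.ofReal (g x)) :
    renyiDiv α P R = (((α - 1)⁻¹ : ℝ) : EReal) *
      ENNReal.log (∫⁻ x, ENNReal.ofReal (g x) ^ α ∂(R)) := by
  have hG : Measurable fun x => ENNReal.ofReal (g x) := hg.ennreal_ofReal
  have hsum : P + R = R.withDensity fun x => ENNReal.ofReal (g x + 1) := by
    have : (fun x => ENNReal.ofReal (g x + 1)) = (fun x => ENNReal.ofReal (g x)) + 1 := by
      funext x
      simp [ENNReal.ofReal_add (hg0 x).le]
    rw [this, withDensity_add_right _ measurable_one, withDensity_one, ← hP]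
  have hG1 : Measurable fun x => ENNReal.ofReal (g x + 1) := (hg.add_const 1).ennreal_ofReal
  have hmk : ∀ h : E → ℝ, Measurable h → (∀ x, 0 < h x) →
      (R.withDensity fun x => ENNReal.ofReal (h x)) =
        (P + R).withDensity fun x => ENNReal.ofReal (h x / (g x + 1)) := by
    intro h hh hh0
    rw [hsum, ← withDensity_mul _ hG1 (by fun_prop)]
    congr 1
    funext x
    have := hg0 x
    rw [Pi.mul_apply, ← ENNReal.ofReal_mul (by positivity)]
    congr 1
    field_simp
  have hPd : P = (P + R).withDensity fun x => ENNReal.ofReal (g x / (g x + 1)) := by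
    rw [← hmk g hg hg0, ← hP]
  have hRd : R = (P + R).withDensity fun x => ENNReal.ofReal (1 / (g x + 1)) := by
    rw [← hmk (fun _ => 1) measurable_const fun _ => one_pos]
    simp
  have h1 : P.rnDeriv (P + R) =ᵐ[P + R] fun x => ENNReal.ofReal (g x / (g x + 1)) := by
    have := Measure.rnDeriv_withDensity (P + R)
      (f := fun x => ENNReal.ofReal (g x / (g x + 1))) (by fun_prop)
    rwa [← hPd] at this
  have h2 : R.rnDeriv (P + R) =ᵐ[P + R] fun x => ENNReal.ofReal (1 / (g x + 1)) := by
    have := Measure.rnDeriv_withDensity (P + R)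
      (f := fun x => ENNReal.ofReal (1 / (g x + 1))) (by fun_prop)
    rwa [← hRd] at this
  rw [renyiDiv]
  congr 2
  have h3 : ∫⁻ x, (P.rnDeriv (P + R) x) ^ α * (R.rnDeriv (P + R) x) ^ (1 - α) ∂(P + R) =
      ∫⁻ x, (ENNReal.ofReal (g x / (g x + 1))) ^ α *
        (ENNReal.ofReal (1 / (g x + 1))) ^ (1 - α) ∂(P + R) := by
    refine lintegral_congr_ae ?_
    filter_upwards [h1, h2] with x e1 e2
    rw [e1, e2]
  rw [h3, hsum, lintegral_withDensity_eq_lintegral_mul _ hG1 (by fun_prop)]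
  refine lintegral_congr fun x => ?_
  have := hg0 x
  have hpos : 0 < g x + 1 := by positivity
  rw [Pi.mul_apply, ENNReal.ofReal_rpow_of_pos (by positivity),
    ENNReal.ofReal_rpow_of_pos (by positivity), ENNReal.ofReal_rpow_of_pos (by positivity),
    ← ENNReal.ofReal_mul (by positivity), ← ENNReal.ofReal_mul (by positivity)]
  congr 1
  rw [Real.div_rpow this.le hpos.le, Real.div_rpow zero_le_one hpos.le, Real.one_rpow,
    div_mul_div_comm, mul_one, ← Real.rpow_add hpos]
  simp
  field_simp

/-- Hölder with exponents 1/α and 1/(1-α) against the constant 1. -/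
theorem affinity_le_one (hm : 1 ≤ m) (hp : 1 ≤ p) {α σ : ℝ} (hα : 0 < α) (hα1 : α < 1)
    (hσ : 0 < σ) (M N : Matrix (Fin m) (Fin p) ℝ) : affinity α σ M N ≤ 1 := by
  have := isProbabilityMeasure_obsLaw hm hp σ M
  have := isProbabilityMeasure_obsLaw hm hp σ N
  have hr : Measurable fun x => ENNReal.ofReal (obsRatio σ M N x) :=
    (measurable_obsRatio σ M N).ennreal_ofReal
  have hone : ∫⁻ x, ENNReal.ofReal (obsRatio σ M N x) ∂(obsLaw σ N) = 1 := by
    have := measure_univ (μ := obsLaw σ M)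
    rwa [obsLaw_eq_withDensity hσ M N, withDensity_apply _ MeasurableSet.univ,
      Measure.restrict_univ] at this
  have h := ENNReal.lintegral_mul_le_Lp_mul_Lq (obsLaw σ N)
    (p := 1 / α) (q := 1 / (1 - α))
    (by
      rw [Real.holderConjugate_iff]
      constructor
      · rw [lt_div_iff₀ hα]; linarith
      · simp)
    (f := fun x => ENNReal.ofReal (obsRatio σ M N x) ^ α) (g := fun _ => 1)
    (hr.pow_const _).aemeasurable (by fun_prop)
  have e : ∀ x : ℝ≥0∞, (x ^ α) ^ (1 / α) = x := fun x => by
    rw [← ENNReal.rpow_mul, mul_one_div_cancel hα.ne', ENNReal.rpow_one]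
  simp only [e, hone] at h
  simpa [affinity] using h

theorem affinity_pos (hm : 1 ≤ m) (hp : 1 ≤ p) {α σ : ℝ}
    (M N : Matrix (Fin m) (Fin p) ℝ) : affinity α σ M N ≠ 0 := by
  have := isProbabilityMeasure_obsLaw hm hp σ N
  have hr : Measurable fun x => ENNReal.ofReal (obsRatio σ M N x) ^ α :=
    (measurable_obsRatio σ M N).ennreal_ofReal.pow_const _
  rw [affinity, Ne, lintegral_eq_zero_iff hr]
  intro h
  have : ∀ᵐ x ∂(obsLaw σ N), False := by
    filter_upwards [h] with x hx
    have h0 : 0 < ENNReal.ofReal (obsRatio σ M N x) :=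
      ENNReal.ofReal_pos.2 (obsRatio_pos σ M N x)
    exact (ENNReal.rpow_pos h0 ENNReal.ofReal_ne_top).ne' hx
  exact (IsProbabilityMeasure.ne_zero (obsLaw σ N)) (by simpa using this)

/-- The affinity lies in (0,1], so the extended logarithm is a real number and truncation at zero
loses nothing. -/
theorem dist_eq (hm : 1 ≤ m) (hp : 1 ≤ p) {α σ : ℝ} (hα : 0 < α) (hα1 : α < 1)
    (hσ : 0 < σ) (M N : Matrix (Fin m) (Fin p) ℝ) :
    dist α σ M N = ENNReal.ofReal ((1 - α)⁻¹ * -Real.log (affinity α σ M N).toReal) := by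
  have := isProbabilityMeasure_obsLaw hm hp σ M
  have := isProbabilityMeasure_obsLaw hm hp σ N
  have hA1 := affinity_le_one hm hp hα hα1 hσ M N
  rw [dist, renyiDiv_withDensity α _ (measurable_obsRatio σ M N) (obsRatio_pos σ M N) _
    (obsLaw_eq_withDensity hσ M N)]
  change ((((α - 1)⁻¹ : ℝ) : EReal) * ENNReal.log (affinity α σ M N)).toENNReal = _
  have hlog : ENNReal.log (affinity α σ M N) =
      ((Real.log (affinity α σ M N).toReal : ℝ) : EReal) :=
    ENNReal.log_pos_real (affinity_pos hm hp M N) (hA1.trans_lt ENNReal.one_lt_top).ne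
  rw [hlog, ← EReal.coe_mul, EReal.toENNReal_of_ne_top (EReal.coe_ne_top _), EReal.toReal_coe,
    ← neg_sub 1 α, inv_neg]
  congr 1
  ring

end Observation

end MatrixVB

end

noncomputable section

namespace MatrixVB

/-! ### The PAC-Bayesian oracle inequality for the variational approximation. -/

section Oracle

open InformationTheory

variable {m p K n : ℕ}

theorem measurable_toMatrix_entry :
    Measurable fun q : (Fin m × Fin p) × Param m p K => q.2.toMatrix q.1.1 q.1.2 := by
  refine measurable_from_prod_countable_right fun ij => ?_
  simp only [Param.toMatrix, Matrix.mul_apply, Matrix.of_apply, Matrix.transpose_apply]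
  fun_prop

/-- The log-likelihood ratio `log (L_n(N) / L_n(M))`. -/
def excessLoss (σ : ℝ) (N : Matrix (Fin m) (Fin p) ℝ) (x : Fin n → Obs m p)
    (M : Matrix (Fin m) (Fin p) ℝ) : ℝ :=
  ∑ k, (((x k).2 - M (x k).1.1 (x k).1.2) ^ 2 - ((x k).2 - N (x k).1.1 (x k).1.2) ^ 2) /
    (2 * σ ^ 2)

theorem measurable_excessLoss (σ : ℝ) (N : Matrix (Fin m) (Fin p) ℝ) :
    Measurable fun q : (Fin n → Obs m p) × Param m p K => excessLoss σ N q.1 q.2.toMatrix := by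
  unfold excessLoss
  refine Finset.measurable_sum _ fun k _ => ?_
  have h1 : Measurable fun q : (Fin n → Obs m p) × Param m p K =>
      q.2.toMatrix (q.1 k).1.1 (q.1 k).1.2 :=
    measurable_toMatrix_entry.comp (f := fun q : (Fin n → Obs m p) × Param m p K =>
      ((q.1 k).1, q.2)) (by fun_prop)
  have h2 : Measurable fun q : (Fin n → Obs m p) × Param m p K =>
      N (q.1 k).1.1 (q.1 k).1.2 :=
    (measurable_entry N).comp (f := fun q : (Fin n → Obs m p) × Param m p K => q.1 k)
      (by fun_prop)
  fun_prop

theorem prod_obsRatio (σ : ℝ) (M N : Matrix (Fin m) (Fin p) ℝ) (x : Fin n → Obs m p) :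
    ∏ k, obsRatio σ M N (x k) = Real.exp (-excessLoss σ N x M) := by
  rw [excessLoss, ← Finset.sum_neg_distrib, Real.exp_sum]
  refine Finset.prod_congr rfl fun k _ => ?_
  rw [obsRatio]
  congr 1
  ring

theorem likelihood_rpow (hm : 1 ≤ m) (hp : 1 ≤ p) {σ : ℝ} (hσ : 0 < σ) (α : ℝ)
    (M N : Matrix (Fin m) (Fin p) ℝ) (x : Fin n → Obs m p) :
    ENNReal.ofReal (likelihood σ x M ^ α) = ENNReal.ofReal (likelihood σ x N ^ α) *
      ENNReal.ofReal (Real.exp (-(α * excessLoss σ N x M))) := by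
  have hN : 0 < likelihood σ x N := Finset.prod_pos fun k _ => obsDensity_pos hm hp hσ N _
  have : likelihood σ x M = likelihood σ x N * Real.exp (-excessLoss σ N x M) := by
    rw [← prod_obsRatio, likelihood, likelihood, ← Finset.prod_mul_distrib]
    refine Finset.prod_congr rfl fun k _ => ?_
    rw [obsDensity_eq_mul σ M N, mul_comm]
  rw [this, Real.mul_rpow hN.le (Real.exp_nonneg _), ← Real.exp_mul,
    ENNReal.ofReal_mul (by positivity)]
  congr 3
  ring

theorem isProbabilityMeasure_prior {a b : ℝ} (ha : 0 < a) (hb : 0 < b) :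
    IsProbabilityMeasure (prior m p K a b) := by
  have := isProbabilityMeasure_gammaMeasure ha hb
  have : IsProbabilityMeasure (invGammaMeasure a b) :=
    Measure.isProbabilityMeasure_map (by fun_prop)
  exact Measure.isProbabilityMeasure_map (by fun_prop)

/-- Dropping the residuals at `M` bounds the likelihood ratio uniformly in `M` for each sample;
hence the posterior normaliser is finite for every sample. -/
theorem neg_excessLoss_le (σ : ℝ) (N M : Matrix (Fin m) (Fin p) ℝ) (x : Fin n → Obs m p) :
    -excessLoss σ N x M ≤ ∑ k, ((x k).2 - N (x k).1.1 (x k).1.2) ^ 2 / (2 * σ ^ 2) := by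
  rw [excessLoss, ← Finset.sum_neg_distrib]
  refine Finset.sum_le_sum fun k _ => ?_
  rw [← neg_div]
  gcongr
  linarith [sq_nonneg ((x k).2 - M (x k).1.1 (x k).1.2)]

theorem lintegral_exp_excessLoss_ne_zero {a b : ℝ} (ha : 0 < a) (hb : 0 < b) (α σ : ℝ)
    (N : Matrix (Fin m) (Fin p) ℝ) (x : Fin n → Obs m p) :
    ∫⁻ θ, ENNReal.ofReal (Real.exp (-(α * excessLoss σ N x θ.toMatrix))) ∂(prior m p K a b) ≠
      0 := by
  have := isProbabilityMeasure_prior (m := m) (p := p) (K := K) ha hb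
  have hmeas : Measurable fun θ : Param m p K => excessLoss σ N x θ.toMatrix :=
    (measurable_excessLoss σ N).comp (f := fun θ => (x, θ)) (by fun_prop)
  rw [Ne, lintegral_eq_zero_iff (by fun_prop)]
  intro h
  have h' : ∀ᵐ θ ∂(prior m p K a b), False := by
    filter_upwards [h] with θ hθ
    have h0 := ENNReal.ofReal_pos.2 (Real.exp_pos (-(α * excessLoss σ N x θ.toMatrix)))
    exact h0.ne' hθ
  exact (IsProbabilityMeasure.ne_zero (prior m p K a b)) (by simpa using h')

theorem lintegral_exp_excessLoss_ne_top {a b : ℝ} (ha : 0 < a) (hb : 0 < b) {α : ℝ}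
    (hα : 0 < α) (σ : ℝ) (N : Matrix (Fin m) (Fin p) ℝ) (x : Fin n → Obs m p) :
    ∫⁻ θ, ENNReal.ofReal (Real.exp (-(α * excessLoss σ N x θ.toMatrix))) ∂(prior m p K a b) ≠
      ⊤ := by
  have := isProbabilityMeasure_prior (m := m) (p := p) (K := K) ha hb
  refine ((lintegral_mono fun θ => ENNReal.ofReal_le_ofReal (Real.exp_le_exp.2 ?_)).trans_lt
    (b := ∫⁻ _, ENNReal.ofReal (Real.exp
      (α * ∑ k, ((x k).2 - N (x k).1.1 (x k).1.2) ^ 2 / (2 * σ ^ 2))) ∂(prior m p K a b)) ?_).ne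
  · rw [← mul_neg]
    exact mul_le_mul_of_nonneg_left (neg_excessLoss_le σ N _ x) hα.le
  · simp

/-- The factor L_n(N)^α does not depend on θ and disappears in the normalisation, so the posterior
can be expressed through likelihood ratios relative to `N`. -/
theorem temperedPosterior_eq (hm : 1 ≤ m) (hp : 1 ≤ p) {α σ : ℝ}
    (hσ : 0 < σ) (a b : ℝ) (N : Matrix (Fin m) (Fin p) ℝ) (x : Fin n → Obs m p) :
    temperedPosterior (K := K) α σ a b x =
      (∫⁻ θ, ENNReal.ofReal (Real.exp (-(α * excessLoss σ N x θ.toMatrix)))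
        ∂(prior m p K a b))⁻¹ • (prior m p K a b).withDensity
          fun θ => ENNReal.ofReal (Real.exp (-(α * excessLoss σ N x θ.toMatrix))) := by
  have hmeas : Measurable fun θ : Param m p K => excessLoss σ N x θ.toMatrix :=
    (measurable_excessLoss σ N).comp (f := fun θ => (x, θ)) (by fun_prop)
  have hN : 0 < likelihood σ x N := Finset.prod_pos fun k _ => obsDensity_pos hm hp hσ N _
  have hc0 : ENNReal.ofReal (likelihood σ x N ^ α) ≠ 0 :=
    (ENNReal.ofReal_pos.2 (Real.rpow_pos_of_pos hN _)).ne'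
  have hL : (fun θ : Param m p K => ENNReal.ofReal (likelihood σ x θ.toMatrix ^ α)) =
      fun θ => ENNReal.ofReal (likelihood σ x N ^ α) *
        ENNReal.ofReal (Real.exp (-(α * excessLoss σ N x θ.toMatrix))) :=
    funext fun θ => likelihood_rpow hm hp hσ α _ N x
  rw [temperedPosterior, hL, lintegral_const_mul _ (by fun_prop), ENNReal.mul_inv (Or.inl hc0)
    (Or.inl ENNReal.ofReal_ne_top)]
  have : (fun θ : Param m p K => ENNReal.ofReal (likelihood σ x N ^ α) *
      ENNReal.ofReal (Real.exp (-(α * excessLoss σ N x θ.toMatrix)))) =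
      ENNReal.ofReal (likelihood σ x N ^ α) •
        fun θ => ENNReal.ofReal (Real.exp (-(α * excessLoss σ N x θ.toMatrix))) := rfl
  rw [this, withDensity_smul _ (by fun_prop), smul_smul, mul_right_comm,
    ENNReal.inv_mul_cancel hc0 ENNReal.ofReal_ne_top, one_mul]

/-- The exponential moment `∫ exp(n (1 - α) D_α(P_M, P_N)) (L_n(M) / L_n(N))^α dπ`. -/
def expMoment (a b α σ : ℝ) (N : Matrix (Fin m) (Fin p) ℝ) (x : Fin n → Obs m p) (K : ℕ) : ℝ≥0∞ :=
  ∫⁻ θ, ((affinity α σ θ.toMatrix N)⁻¹) ^ n *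
    ENNReal.ofReal (Real.exp (-(α * excessLoss σ N x θ.toMatrix))) ∂(prior m p K a b)

theorem measurable_affinity (hm : 1 ≤ m) (hp : 1 ≤ p) (α σ : ℝ) (N : Matrix (Fin m) (Fin p) ℝ) :
    Measurable fun θ : Param m p K => affinity α σ θ.toMatrix N := by
  have := isProbabilityMeasure_obsLaw hm hp σ N
  have h1 : Measurable fun q : Param m p K × Obs m p => q.1.toMatrix q.2.1.1 q.2.1.2 :=
    measurable_toMatrix_entry.comp (f := fun q : Param m p K × Obs m p => (q.2.1, q.1))
      (by fun_prop)
  have h2 : Measurable fun q : Param m p K × Obs m p => N q.2.1.1 q.2.1.2 :=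
    (measurable_entry N).comp measurable_snd
  unfold affinity obsRatio
  exact Measurable.lintegral_prod_right'
    (f := fun q : Param m p K × Obs m p => ENNReal.ofReal (Real.exp
      (((q.2.2 - N q.2.1.1 q.2.1.2) ^ 2 - (q.2.2 - q.1.toMatrix q.2.1.1 q.2.1.2) ^ 2) /
        (2 * σ ^ 2))) ^ α) (by fun_prop)

theorem measurable_expMoment_integrand (hm : 1 ≤ m) (hp : 1 ≤ p) (α σ : ℝ)
    (N : Matrix (Fin m) (Fin p) ℝ) :
    Measurable fun q : (Fin n → Obs m p) × Param m p K =>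
      ((affinity α σ q.2.toMatrix N)⁻¹) ^ n *
        ENNReal.ofReal (Real.exp (-(α * excessLoss σ N q.1 q.2.toMatrix))) :=
  (((measurable_affinity hm hp α σ N).comp measurable_snd).inv.pow_const n).mul
    ((measurable_excessLoss σ N).const_mul α).neg.exp.ennreal_ofReal

theorem lintegral_expMoment_le (hm : 1 ≤ m) (hp : 1 ≤ p) {α σ a b : ℝ} (hα : 0 < α)
    (hα1 : α < 1) (hσ : 0 < σ) (ha : 0 < a) (hb : 0 < b) (N : Matrix (Fin m) (Fin p) ℝ) :
    ∫⁻ x, expMoment a b α σ N x K ∂(sampleLaw n σ N) ≤ 1 := by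
  have := isProbabilityMeasure_obsLaw hm hp σ N
  have := isProbabilityMeasure_prior (m := m) (p := p) (K := K) ha hb
  have : IsProbabilityMeasure (sampleLaw n σ N) := by unfold sampleLaw; infer_instance
  have hE := measurable_excessLoss (K := K) (n := n) σ N
  unfold expMoment
  rw [lintegral_lintegral_swap (measurable_expMoment_integrand hm hp α σ N).aemeasurable]
  -- For fixed θ the sample integral factorises into n copies of the affinity, which the prefactor
  -- inverts exactly.
  have hin : ∀ θ : Param m p K, ∫⁻ x, ((affinity α σ θ.toMatrix N)⁻¹) ^ n *
      ENNReal.ofReal (Real.exp (-(α * excessLoss σ N x θ.toMatrix))) ∂(sampleLaw n σ N) = 1 := by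
    intro θ
    have hEθ : Measurable fun x : Fin n → Obs m p => excessLoss σ N x θ.toMatrix :=
      hE.comp (f := fun x => (x, θ)) (by fun_prop)
    rw [lintegral_const_mul _ (by fun_prop)]
    have h1 : ∀ x : Fin n → Obs m p,
        ENNReal.ofReal (Real.exp (-(α * excessLoss σ N x θ.toMatrix))) =
          ∏ k, ENNReal.ofReal (obsRatio σ θ.toMatrix N (x k)) ^ α := by
      intro x
      rw [ENNReal.prod_rpow_of_nonneg hα.le, ← ENNReal.ofReal_prod_of_nonneg
        fun k _ => (obsRatio_pos _ _ _ _).le, prod_obsRatio,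
        ENNReal.ofReal_rpow_of_pos (Real.exp_pos _), ← Real.exp_mul]
      congr 2
      ring
    simp_rw [h1]
    rw [sampleLaw, lintegral_pi_prod (fun _ => obsLaw σ N)
      (fun _ y => ENNReal.ofReal (obsRatio σ θ.toMatrix N y) ^ α)
      fun _ => (measurable_obsRatio _ _ _).ennreal_ofReal.pow_const _, Finset.prod_const,
      Finset.card_univ, Fintype.card_fin]
    change _ * (affinity α σ θ.toMatrix N) ^ n = 1
    rw [← mul_pow, ENNReal.inv_mul_cancel (affinity_pos hm hp _ _)
      ((affinity_le_one hm hp hα hα1 hσ _ _).trans_lt ENNReal.one_lt_top).ne, one_pow]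
  simp [hin]

theorem isProbabilityMeasure_of_mem_meanField {ρ : Measure (Param m p K)}
    (h : ρ ∈ meanField m p K) : IsProbabilityMeasure ρ := by
  obtain ⟨ρU, ρV, ργ, rfl⟩ := h
  infer_instance

/-- The inequality for a single sample. The term w - 1 stands in for log w, so no integrability of
log w is required later; nonnegativity of the bound lets its expectation be taken as a real
integral. -/
theorem vb_risk_le (hm : 1 ≤ m) (hp : 1 ≤ p) {α σ a b : ℝ} (hα : 0 < α)
    (hα1 : α < 1) (hσ : 0 < σ) (ha : 0 < a) (hb : 0 < b) (N : Matrix (Fin m) (Fin p) ℝ)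
    {ρ : Measure (Param m p K)} (hρF : ρ ∈ meanField m p K) {φ : Param m p K → ℝ≥0∞}
    (hφ : Measurable φ) (hρ : ρ = (prior m p K a b).withDensity φ) {ψ : Param m p K → ℝ}
    (hψ : Integrable ψ ρ) (hle : ∀ᵐ θ ∂ρ, Real.log (φ θ).toReal ≤ ψ θ)
    (x : Fin n → Obs m p) (hloss : Integrable (fun θ => excessLoss σ N x θ.toMatrix) ρ)
    (hfin : expMoment a b α σ N x K ≠ ⊤) {ρ' : Measure (Param m p K)}
    (hvb : IsVBApprox α σ a b x ρ') :
    ENNReal.ofReal (n * (1 - α)) * ∫⁻ θ, dist α σ θ.toMatrix N ∂ρ' ≤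
      ENNReal.ofReal (∫ θ, ψ θ ∂ρ + α * ∫ θ, excessLoss σ N x θ.toMatrix ∂ρ +
        ((expMoment a b α σ N x K).toReal - 1)) ∧
    0 ≤ ∫ θ, ψ θ ∂ρ + α * ∫ θ, excessLoss σ N x θ.toMatrix ∂ρ +
        ((expMoment a b α σ N x K).toReal - 1) := by
  have := isProbabilityMeasure_prior (m := m) (p := p) (K := K) ha hb
  have := isProbabilityMeasure_of_mem_meanField hρF
  have := isProbabilityMeasure_of_mem_meanField hvb.1
  have hE : Measurable fun θ : Param m p K => excessLoss σ N x θ.toMatrix :=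
    (measurable_excessLoss σ N).comp (f := fun θ => (x, θ)) (by fun_prop)
  have hA := measurable_affinity (K := K) hm hp α σ N
  set ℓ : Param m p K → ℝ≥0∞ :=
    fun θ => ENNReal.ofReal (Real.exp (-(α * excessLoss σ N x θ.toMatrix))) with hℓ
  have hℓm : Measurable ℓ := by fun_prop
  set Z := ∫⁻ θ, ℓ θ ∂(prior m p K a b) with hZ
  have hZ0 : Z ≠ 0 := lintegral_exp_excessLoss_ne_zero ha hb α σ N x
  have hZt : Z ≠ ⊤ := lintegral_exp_excessLoss_ne_top ha hb hα σ N x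
  have hpost : temperedPosterior (K := K) α σ a b x =
      Z⁻¹ • (prior m p K a b).withDensity ℓ := temperedPosterior_eq hm hp hσ a b N x
  set P := temperedPosterior (K := K) α σ a b x with hP
  have hPprob : IsProbabilityMeasure P := by
    constructor
    rw [hpost, Measure.smul_apply, withDensity_apply _ MeasurableSet.univ,
      Measure.restrict_univ, smul_eq_mul, ENNReal.inv_mul_cancel hZ0 hZt]
  have hZpos : 0 < Z.toReal := ENNReal.toReal_pos hZ0 hZt
  -- Relative to the posterior, whose prior density is ℓ/Z, the comparison measure has density φ
  -- Z/ℓ. Its logarithm contributes log Z + α · loss.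
  have hρP : ρ = P.withDensity fun θ => Z * (ℓ θ)⁻¹ * φ θ := by
    have e : (fun θ => Z * (ℓ θ)⁻¹ * φ θ) = Z • fun θ => (ℓ θ)⁻¹ * φ θ := by
      funext θ; simp [mul_assoc]
    rw [e, withDensity_smul _ (by fun_prop), hpost, withDensity_smul_measure, smul_smul,
      ENNReal.mul_inv_cancel hZ0 hZt, one_smul, ← withDensity_mul _ hℓm (by fun_prop), hρ]
    congr 1
    funext θ
    rw [Pi.mul_apply, ← mul_assoc, ENNReal.mul_inv_cancel
      (ENNReal.ofReal_pos.2 (Real.exp_pos _)).ne' ENNReal.ofReal_ne_top, one_mul]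
  have hφpos : ∀ᵐ θ ∂ρ, φ θ ≠ 0 := by
    rw [hρ, ae_withDensity_iff hφ]
    exact Filter.Eventually.of_forall fun θ h => h
  have hφtop : ∀ᵐ θ ∂ρ, φ θ ≠ ⊤ := by
    have hone : ∫⁻ θ, φ θ ∂(prior m p K a b) = 1 := by
      have := measure_univ (μ := ρ)
      rwa [hρ, withDensity_apply _ MeasurableSet.univ, Measure.restrict_univ] at this
    have hac : ρ ≪ prior m p K a b := hρ ▸ withDensity_absolutelyContinuous _ _
    exact hac ((ae_lt_top hφ (by simp [hone])).mono fun θ h => h.ne)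
  have hKL := klDiv_le_of_log_le (ρ := ρ) (P := P) (φ := fun θ => Z * (ℓ θ)⁻¹ * φ θ)
    (by fun_prop) hρP
    (ψ := fun θ => ψ θ + (Real.log Z.toReal + α * excessLoss σ N x θ.toMatrix))
    (hψ.add ((integrable_const _).add (hloss.const_mul α))) (by
      filter_upwards [hle, hφpos, hφtop] with θ h1 h2 h3
      have h4 : 0 < (φ θ).toReal := ENNReal.toReal_pos h2 h3
      rw [ENNReal.toReal_mul, ENNReal.toReal_mul, ENNReal.toReal_inv, hℓ]
      simp only
      rw [ENNReal.toReal_ofReal (Real.exp_nonneg _), ← Real.exp_neg, neg_neg,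
        Real.log_mul (by positivity) h4.ne', Real.log_mul hZpos.ne' (Real.exp_ne_zero _),
        Real.log_exp]
      linarith)
  have hint : ∫ θ, (ψ θ + (Real.log Z.toReal + α * excessLoss σ N x θ.toMatrix)) ∂ρ =
      ∫ θ, ψ θ ∂ρ + (Real.log Z.toReal + α * ∫ θ, excessLoss σ N x θ.toMatrix ∂ρ) := by
    have e1 := integral_add hψ ((integrable_const (Real.log Z.toReal)).add (hloss.const_mul α))
    simp only [Pi.add_apply] at e1
    rw [e1, integral_add (integrable_const _) (hloss.const_mul α), integral_const_mul]
    simp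
  rw [hint] at hKL
  have hmin : klDiv ρ' P ≤ klDiv ρ P := hvb.2 hρF
  set f : Param m p K → ℝ := fun θ => n * -Real.log (affinity α σ θ.toMatrix N).toReal with hf
  have hAle : ∀ θ : Param m p K, (affinity α σ θ.toMatrix N).toReal ≤ 1 := fun θ => by
    simpa using (ENNReal.toReal_mono ENNReal.one_ne_top
      (affinity_le_one hm hp hα hα1 hσ θ.toMatrix N))
  have hAt : ∀ θ : Param m p K, affinity α σ θ.toMatrix N ≠ ⊤ := fun θ =>
    ((affinity_le_one hm hp hα hα1 hσ _ _).trans_lt ENNReal.one_lt_top).ne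
  have hApos : ∀ θ : Param m p K, 0 < (affinity α σ θ.toMatrix N).toReal := fun θ =>
    ENNReal.toReal_pos (affinity_pos hm hp _ _) (hAt θ)
  have hlog0 : ∀ θ : Param m p K, 0 ≤ -Real.log (affinity α σ θ.toMatrix N).toReal := fun θ =>
    neg_nonneg.2 (Real.log_nonpos (hApos θ).le (hAle θ))
  have hf0 : ∀ θ, 0 ≤ f θ := fun θ => mul_nonneg (Nat.cast_nonneg n) (hlog0 θ)
  have hfm : Measurable f := by fun_prop
  have hfdist : ∀ θ : Param m p K,
      ENNReal.ofReal (n * (1 - α)) * dist α σ θ.toMatrix N = ENNReal.ofReal (f θ) := by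
    intro θ
    have h1α : 0 < 1 - α := by linarith
    rw [dist_eq hm hp hα hα1 hσ, ← ENNReal.ofReal_mul (by positivity), hf]
    congr 1
    field_simp
  have hexpf : ∀ θ, ENNReal.ofReal (Real.exp (f θ)) = ((affinity α σ θ.toMatrix N)⁻¹) ^ n := by
    intro θ
    rw [hf]
    simp only
    rw [mul_comm, Real.exp_mul, Real.exp_neg, Real.exp_log (hApos θ), Real.rpow_natCast,
      ENNReal.ofReal_pow (inv_nonneg.2 (hApos θ).le), ENNReal.ofReal_inv_of_pos (hApos θ),
      ENNReal.ofReal_toReal (hAt θ)]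
  set w := expMoment a b α σ N x K with hw
  have hmom : ∫⁻ θ, ENNReal.ofReal (Real.exp (f θ)) ∂P = Z⁻¹ * w := by
    simp_rw [hexpf]
    rw [hpost, lintegral_smul_measure, smul_eq_mul, lintegral_withDensity_eq_lintegral_mul _ hℓm
      (by fun_prop), hw, expMoment]
    congr 1
    refine lintegral_congr fun θ => ?_
    rw [Pi.mul_apply, mul_comm]
  -- Affinities are at most one, so log w - log Z ≥ 0 and this term may be added inside
  -- `ENNReal.ofReal`.
  have hwZ : Z ≤ w := by
    refine lintegral_mono fun θ => ?_
    refine le_mul_of_one_le_left zero_le (one_le_pow₀ ?_)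
    exact ENNReal.one_le_inv.2 (affinity_le_one hm hp hα hα1 hσ _ _)
  have hwZ' : Z.toReal ≤ w.toReal := ENNReal.toReal_mono hfin hwZ
  have hwpos : 0 < w.toReal := hZpos.trans_le hwZ'
  have hDV := lintegral_le_klDiv_add_log ρ' P hfm hf0
    (by rw [hmom]; exact ENNReal.mul_ne_top (ENNReal.inv_ne_top.2 hZ0) hfin)
  have hlogw : Real.log (∫⁻ θ, ENNReal.ofReal (Real.exp (f θ)) ∂P).toReal =
      Real.log w.toReal - Real.log Z.toReal := by
    rw [hmom, ENNReal.toReal_mul, ENNReal.toReal_inv, mul_comm, ← div_eq_mul_inv,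
      Real.log_div hwpos.ne' hZpos.ne']
  rw [hlogw] at hDV
  have hlogle : Real.log Z.toReal ≤ Real.log w.toReal := Real.log_le_log hZpos hwZ'
  have hlogw1 := Real.log_le_sub_one_of_pos hwpos
  constructor
  · calc ENNReal.ofReal (n * (1 - α)) * ∫⁻ θ, dist α σ θ.toMatrix N ∂ρ'
        = ∫⁻ θ, ENNReal.ofReal (f θ) ∂ρ' := by
          rw [← lintegral_const_mul' _ _ ENNReal.ofReal_ne_top]
          exact lintegral_congr hfdist
      _ ≤ ENNReal.ofReal (∫ θ, ψ θ ∂ρ +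
            (Real.log Z.toReal + α * ∫ θ, excessLoss σ N x θ.toMatrix ∂ρ)) +
          ENNReal.ofReal (Real.log w.toReal - Real.log Z.toReal) :=
          hDV.trans (add_le_add_left (hmin.trans hKL.1) _)
      _ ≤ _ := by
          rw [← ENNReal.ofReal_add hKL.2 (by linarith)]
          exact ENNReal.ofReal_le_ofReal (by linarith)
  · linarith [hKL.2]

theorem vb_expected_risk_le (hm : 1 ≤ m) (hp : 1 ≤ p) {α σ a b : ℝ} (hα : 0 < α)
    (hα1 : α < 1) (hσ : 0 < σ) (ha : 0 < a) (hb : 0 < b) (N : Matrix (Fin m) (Fin p) ℝ)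
    {ρ : Measure (Param m p K)} (hρF : ρ ∈ meanField m p K) {φ : Param m p K → ℝ≥0∞}
    (hφ : Measurable φ) (hρ : ρ = (prior m p K a b).withDensity φ) {ψ : Param m p K → ℝ}
    (hψ : Integrable ψ ρ) (hle : ∀ᵐ θ ∂ρ, Real.log (φ θ).toReal ≤ ψ θ)
    (hloss : ∀ x : Fin n → Obs m p, Integrable (fun θ => excessLoss σ N x θ.toMatrix) ρ)
    (hint : Integrable (fun x : Fin n → Obs m p => ∫ θ, excessLoss σ N x θ.toMatrix ∂ρ)
      (sampleLaw n σ N))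
    {vb : (Fin n → Obs m p) → Measure (Param m p K)}
    (hvb : ∀ᵐ x ∂(sampleLaw n σ N), IsVBApprox α σ a b x (vb x)) :
    ENNReal.ofReal (n * (1 - α)) *
      ∫⁻ x, ∫⁻ θ, dist α σ θ.toMatrix N ∂(vb x) ∂(sampleLaw n σ N) ≤
      ENNReal.ofReal (∫ θ, ψ θ ∂ρ +
        α * ∫ x, ∫ θ, excessLoss σ N x θ.toMatrix ∂ρ ∂(sampleLaw n σ N)) := by
  have := isProbabilityMeasure_obsLaw hm hp σ N
  have := isProbabilityMeasure_prior (m := m) (p := p) (K := K) ha hb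
  have : IsProbabilityMeasure (sampleLaw n σ N) := by unfold sampleLaw; infer_instance
  have hwm : Measurable fun x : Fin n → Obs m p => expMoment a b α σ N x K := by
    unfold expMoment
    exact (measurable_expMoment_integrand hm hp α σ N).lintegral_prod_right'
  have hw1 := lintegral_expMoment_le (K := K) (n := n) hm hp hα hα1 hσ ha hb N
  have hwt : ∫⁻ x, expMoment a b α σ N x K ∂(sampleLaw n σ N) ≠ ⊤ :=
    (hw1.trans_lt ENNReal.one_lt_top).ne
  have hwfin : ∀ᵐ x ∂(sampleLaw n σ N), expMoment a b α σ N x K < ⊤ := ae_lt_top hwm hwt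
  have hwint : Integrable (fun x : Fin n → Obs m p => (expMoment a b α σ N x K).toReal)
      (sampleLaw n σ N) := integrable_toReal_of_lintegral_ne_top hwm.aemeasurable hwt
  have hwval : ∫ x : Fin n → Obs m p, (expMoment a b α σ N x K).toReal ∂(sampleLaw n σ N) ≤ 1 := by
    rw [integral_toReal hwm.aemeasurable hwfin]
    simpa using ENNReal.toReal_mono ENNReal.one_ne_top hw1
  have hI1 := (integrable_const (∫ θ, ψ θ ∂ρ)).add (hint.const_mul α)
  have hI2 := hwint.sub (integrable_const (1 : ℝ))
  have hpt := (hvb.and hwfin).mono fun x h =>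
    vb_risk_le hm hp hα hα1 hσ ha hb N hρF hφ hρ hψ hle x (hloss x) h.2.ne h.1
  rw [← lintegral_const_mul' _ _ ENNReal.ofReal_ne_top]
  refine (lintegral_mono_ae (hpt.mono fun x hx => hx.1)).trans ?_
  have e0 := ofReal_integral_eq_lintegral_ofReal (hI1.add hI2) (hpt.mono fun x hx => hx.2)
  simp only [Pi.add_apply, Pi.sub_apply] at e0
  rw [← e0]
  refine ENNReal.ofReal_le_ofReal ?_
  have e := integral_add hI1 hI2
  simp only [Pi.add_apply, Pi.sub_apply] at e
  rw [e, integral_add (integrable_const _) (hint.const_mul α), integral_const_mul,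
    integral_sub hwint (integrable_const _)]
  simp only [integral_const, probReal_univ, smul_eq_mul, one_mul]
  linarith

end Oracle

end MatrixVB

end

noncomputable section

namespace MatrixVB

/-! ### Expected loss under the Gaussian comparison measure and under the sample. -/

section Moments

theorem integrable_sq_sub_gaussian (μ : ℝ) (v : NNReal) (c : ℝ) :
    Integrable (fun y : ℝ => (y - c) ^ 2) (gaussianReal μ v) :=
  ((memLp_id_gaussianReal 2).sub (memLp_const c)).integrable_sq

theorem integral_sq_sub_gaussian (μ : ℝ) (v : NNReal) (c : ℝ) :
    ∫ y, (y - c) ^ 2 ∂(gaussianReal μ v) = (μ - c) ^ 2 + v := by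
  have h1 : MemLp (fun y : ℝ => y - c) 2 (gaussianReal μ v) :=
    (memLp_id_gaussianReal 2).sub (memLp_const c)
  have hid : Integrable (fun y : ℝ => y) (gaussianReal μ v) :=
    (memLp_id_gaussianReal 1).integrable le_rfl
  have h2 := variance_eq_sub h1
  have h3 : ∫ y, (y - c) ∂(gaussianReal μ v) = μ - c := by
    rw [integral_sub hid (integrable_const _), integral_id_gaussianReal]
    simp
  rw [variance_sub_const hid.1, variance_fun_id_gaussianReal, h3] at h2
  simp only [Pi.pow_apply] at h2
  linarith

variable {m p K n : ℕ}

/-- The product measure with independent Gaussian rows `N(u, s)` and independent scales. -/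
def gaussianProduct (u : Fin m → Fin K → ℝ) (v : Fin p → Fin K → ℝ) (s : Fin K → NNReal)
    (G : Fin K → Measure ℝ) : Measure (Param m p K) :=
  (Measure.pi fun i => Measure.pi fun k => gaussianReal (u i k) (s k)).prod
    ((Measure.pi fun j => Measure.pi fun k => gaussianReal (v j k) (s k)).prod (Measure.pi G))

/-- Bias and variance are separated twice: over the second factor with the first fixed, then over
the first. The second moment u² + s of the first factor produces the s² term. -/
theorem integrable_bilinear_sq (u v : Fin K → ℝ) (s : Fin K → NNReal) (c : ℝ) :
    Integrable (fun z : (Fin K → ℝ) × (Fin K → ℝ) => (c - ∑ k, z.1 k * z.2 k) ^ 2)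
      ((Measure.pi fun k => gaussianReal (u k) (s k)).prod
        (Measure.pi fun k => gaussianReal (v k) (s k))) ∧
    ∫ z : (Fin K → ℝ) × (Fin K → ℝ), (c - ∑ k, z.1 k * z.2 k) ^ 2
      ∂((Measure.pi fun k => gaussianReal (u k) (s k)).prod
        (Measure.pi fun k => gaussianReal (v k) (s k))) =
      (c - ∑ k, u k * v k) ^ 2 + ∑ k, s k * (u k ^ 2 + v k ^ 2 + s k) := by
  have hin : ∀ x : Fin K → ℝ, ∫ y : Fin K → ℝ, (c - ∑ k, x k * y k) ^ 2
      ∂(Measure.pi fun k => gaussianReal (v k) (s k)) =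
      (c - ∑ k, x k * v k) ^ 2 + ∑ k, s k * x k ^ 2 := by
    intro x
    have := integral_linear_sq_pi_gaussian v s c x
    simpa only [mul_comm (x _)] using this
  have hsq : ∀ k, Integrable (fun x : Fin K → ℝ => (s k : ℝ) * x k ^ 2)
      (Measure.pi fun k => gaussianReal (u k) (s k)) := fun k =>
    (integrable_comp_eval (μ := fun k => gaussianReal (u k) (s k)) (i := k)
      (f := fun y => y ^ 2) (by simpa using integrable_sq_sub_gaussian (u k) (s k) 0)).const_mul _
  have hlin := (memLp_linear_pi_gaussian u s c v).integrable_sq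
  have hI : Integrable (fun z : (Fin K → ℝ) × (Fin K → ℝ) => (c - ∑ k, z.1 k * z.2 k) ^ 2)
      ((Measure.pi fun k => gaussianReal (u k) (s k)).prod
        (Measure.pi fun k => gaussianReal (v k) (s k))) := by
    rw [integrable_prod_iff (by fun_prop)]
    constructor
    · refine Filter.Eventually.of_forall fun x => ?_
      have := (memLp_linear_pi_gaussian v s c x).integrable_sq
      simpa only [mul_comm (x _)] using this
    · have e : ∀ x y : Fin K → ℝ, ‖(c - ∑ k, x k * y k) ^ 2‖ = (c - ∑ k, x k * y k) ^ 2 :=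
        fun x y => by rw [Real.norm_eq_abs, abs_of_nonneg (sq_nonneg _)]
      simp only [e, hin]
      exact hlin.add (integrable_finsetSum _ fun k _ => hsq k)
  refine ⟨hI, ?_⟩
  rw [integral_prod _ hI]
  simp only [hin]
  rw [integral_add hlin (integrable_finsetSum _ fun k _ => hsq k),
    integral_linear_sq_pi_gaussian, integral_finsetSum _ fun k _ => hsq k, add_assoc,
    ← Finset.sum_add_distrib]
  congr 1
  refine Finset.sum_congr rfl fun k _ => ?_
  rw [integral_const_mul, integral_comp_eval (μ := fun k => gaussianReal (u k) (s k)) (i := k)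
    (f := fun y => y ^ 2) (by fun_prop)]
  have := integral_sq_sub_gaussian (u k) (s k) 0
  simp only [sub_zero] at this
  rw [this]
  ring

variable (u : Fin m → Fin K → ℝ) (v : Fin p → Fin K → ℝ) (s : Fin K → NNReal)
  (G : Fin K → Measure ℝ) [∀ k, IsProbabilityMeasure (G k)]

instance : IsProbabilityMeasure (gaussianProduct u v s G) := by
  unfold gaussianProduct
  infer_instance

theorem measurePreserving_rows (i : Fin m) (j : Fin p) :
    MeasurePreserving (fun θ : Param m p K => (θ.1 i, θ.2.1 j)) (gaussianProduct u v s G)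
      ((Measure.pi fun k => gaussianReal (u i k) (s k)).prod
        (Measure.pi fun k => gaussianReal (v j k) (s k))) := by
  refine (measurePreserving_eval (fun i => Measure.pi fun k => gaussianReal (u i k) (s k)) i).prod
    ((measurePreserving_eval (fun j => Measure.pi fun k => gaussianReal (v j k) (s k)) j).comp
      measurePreserving_fst)

theorem measurePreserving_left (i : Fin m) (k : Fin K) :
    MeasurePreserving (fun θ : Param m p K => θ.1 i k) (gaussianProduct u v s G)
      (gaussianReal (u i k) (s k)) :=
  (measurePreserving_eval (fun k => gaussianReal (u i k) (s k)) k).comp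
    ((measurePreserving_eval (fun i => Measure.pi fun k => gaussianReal (u i k) (s k)) i).comp
      measurePreserving_fst)

theorem measurePreserving_right (j : Fin p) (k : Fin K) :
    MeasurePreserving (fun θ : Param m p K => θ.2.1 j k) (gaussianProduct u v s G)
      (gaussianReal (v j k) (s k)) :=
  (measurePreserving_eval (fun k => gaussianReal (v j k) (s k)) k).comp
    ((measurePreserving_eval (fun j => Measure.pi fun k => gaussianReal (v j k) (s k)) j).comp
      (measurePreserving_fst.comp measurePreserving_snd))

theorem measurePreserving_scale (k : Fin K) :
    MeasurePreserving (fun θ : Param m p K => θ.2.2 k) (gaussianProduct u v s G) (G k) :=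
  (measurePreserving_eval G k).comp (measurePreserving_snd.comp measurePreserving_snd)

theorem integral_entry_sq (i : Fin m) (j : Fin p) (c : ℝ) :
    Integrable (fun θ : Param m p K => (c - θ.toMatrix i j) ^ 2) (gaussianProduct u v s G) ∧
    ∫ θ, (c - θ.toMatrix i j) ^ 2 ∂(gaussianProduct u v s G) =
      (c - ∑ k, u i k * v j k) ^ 2 +
        ∑ k, s k * (u i k ^ 2 + v j k ^ 2 + s k) := by
  have hmp := measurePreserving_rows u v s G i j
  obtain ⟨h1, h2⟩ := integrable_bilinear_sq (u i) (v j) s c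
  have e : (fun θ : Param m p K => (c - θ.toMatrix i j) ^ 2) =
      (fun z : (Fin K → ℝ) × (Fin K → ℝ) => (c - ∑ k, z.1 k * z.2 k) ^ 2) ∘
        fun θ : Param m p K => (θ.1 i, θ.2.1 j) := by
    funext θ
    simp [Param.toMatrix, Matrix.mul_apply]
  rw [e]
  refine ⟨hmp.integrable_comp_of_integrable h1, ?_⟩
  rw [← h2, ← hmp.map_eq, integral_map hmp.measurable.aemeasurable (by fun_prop)]
  rfl

/-- The variance of the `(i, j)` entry of `U Vᵗ` under `gaussianProduct`. -/
def entryVar (i : Fin m) (j : Fin p) : ℝ := ∑ k, s k * (u i k ^ 2 + v j k ^ 2 + s k)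

theorem integral_excessLoss (σ : ℝ) (N : Matrix (Fin m) (Fin p) ℝ) (x : Fin n → Obs m p) :
    Integrable (fun θ : Param m p K => excessLoss σ N x θ.toMatrix) (gaussianProduct u v s G) ∧
    ∫ θ, excessLoss σ N x θ.toMatrix ∂(gaussianProduct u v s G) =
      ∑ l, (((x l).2 - ∑ k, u (x l).1.1 k * v (x l).1.2 k) ^ 2 +
        entryVar u v s (x l).1.1 (x l).1.2 - ((x l).2 - N (x l).1.1 (x l).1.2) ^ 2) /
          (2 * σ ^ 2) := by
  unfold excessLoss
  have h := fun l => integral_entry_sq u v s G (x l).1.1 (x l).1.2 (x l).2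
  have hi : ∀ l, Integrable (fun θ : Param m p K =>
      (((x l).2 - θ.toMatrix (x l).1.1 (x l).1.2) ^ 2 - ((x l).2 - N (x l).1.1 (x l).1.2) ^ 2) /
        (2 * σ ^ 2)) (gaussianProduct u v s G) := fun l =>
    ((h l).1.sub (integrable_const _)).div_const _
  refine ⟨integrable_finsetSum _ fun l _ => hi l, ?_⟩
  rw [integral_finsetSum _ fun l _ => hi l]
  refine Finset.sum_congr rfl fun l _ => ?_
  rw [integral_div, integral_sub (h l).1 (integrable_const _), (h l).2, entryVar]
  simp

theorem obsLaw_eq_sum (σ : ℝ) (M : Matrix (Fin m) (Fin p) ℝ) :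
    obsLaw σ M = ((m * p : ℕ) : ℝ≥0∞)⁻¹ • ∑ ij : Fin m × Fin p,
      (gaussianReal (M ij.1 ij.2) (σ ^ 2).toNNReal).map (Prod.mk ij) := by
  refine Measure.ext_of_lintegral _ fun f hf => ?_
  rw [lintegral_obsLaw σ M hf, lintegral_smul_measure, lintegral_finsetSum_measure, smul_eq_mul]
  congr 1
  refine Finset.sum_congr rfl fun ij _ => ?_
  rw [lintegral_map hf (by fun_prop)]

theorem integral_obsLaw (hm : 1 ≤ m) (hp : 1 ≤ p) (σ : ℝ) (M : Matrix (Fin m) (Fin p) ℝ)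
    {f : Obs m p → ℝ} (hf : Measurable f)
    (hfi : ∀ ij : Fin m × Fin p,
      Integrable (fun y => f (ij, y)) (gaussianReal (M ij.1 ij.2) (σ ^ 2).toNNReal)) :
    Integrable f (obsLaw σ M) ∧ ∫ x, f x ∂(obsLaw σ M) = ((m : ℝ) * p)⁻¹ *
      ∑ ij : Fin m × Fin p, ∫ y, f (ij, y) ∂(gaussianReal (M ij.1 ij.2) (σ ^ 2).toNNReal) := by
  have hmk : ∀ ij : Fin m × Fin p, Measurable (Prod.mk ij : ℝ → Obs m p) := fun ij => by fun_prop
  have hI : ∀ ij ∈ (Finset.univ : Finset (Fin m × Fin p)), Integrable f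
      ((gaussianReal (M ij.1 ij.2) (σ ^ 2).toNNReal).map (Prod.mk ij)) := fun ij _ =>
    (integrable_map_measure hf.aestronglyMeasurable (hmk ij).aemeasurable).2 (hfi ij)
  have hmp : ((m * p : ℕ) : ℝ≥0∞) ≠ 0 := by
    have : 0 < m * p := Nat.mul_pos hm hp
    exact_mod_cast this.ne'
  rw [obsLaw_eq_sum]
  constructor
  · exact (integrable_finsetSum_measure.2 hI).smul_measure (ENNReal.inv_ne_top.2 hmp)
  · rw [integral_smul_measure, integral_finsetSum_measure hI, smul_eq_mul, ENNReal.toReal_inv,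
      ENNReal.toReal_natCast, Nat.cast_mul]
    congr 1
    refine Finset.sum_congr rfl fun ij _ => ?_
    rw [integral_map (hmk ij).aemeasurable hf.aestronglyMeasurable]

/-- Both squared residuals carry the noise variance σ², which cancels; bias and the added term `V`
remain. -/
theorem integral_obsLaw_excess (hm : 1 ≤ m) (hp : 1 ≤ p) (σ : ℝ)
    (N A V : Matrix (Fin m) (Fin p) ℝ) :
    Integrable (fun x : Obs m p => ((x.2 - A x.1.1 x.1.2) ^ 2 + V x.1.1 x.1.2 -
      (x.2 - N x.1.1 x.1.2) ^ 2) / (2 * σ ^ 2)) (obsLaw σ N) ∧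
    ∫ x : Obs m p, ((x.2 - A x.1.1 x.1.2) ^ 2 + V x.1.1 x.1.2 -
      (x.2 - N x.1.1 x.1.2) ^ 2) / (2 * σ ^ 2) ∂(obsLaw σ N) =
      ((m : ℝ) * p)⁻¹ * ∑ ij : Fin m × Fin p,
        ((N ij.1 ij.2 - A ij.1 ij.2) ^ 2 + V ij.1 ij.2) / (2 * σ ^ 2) := by
  have hA := measurable_entry A
  have hN := measurable_entry N
  have hV := measurable_entry V
  have h1 := fun (ij : Fin m × Fin p) =>
    integrable_sq_sub_gaussian (N ij.1 ij.2) (σ ^ 2).toNNReal (A ij.1 ij.2)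
  have h2 := fun (ij : Fin m × Fin p) =>
    integrable_sq_sub_gaussian (N ij.1 ij.2) (σ ^ 2).toNNReal (N ij.1 ij.2)
  obtain ⟨h3, h4⟩ := integral_obsLaw hm hp σ N
    (f := fun x : Obs m p => ((x.2 - A x.1.1 x.1.2) ^ 2 + V x.1.1 x.1.2 -
      (x.2 - N x.1.1 x.1.2) ^ 2) / (2 * σ ^ 2)) (by fun_prop)
    fun ij => (((h1 ij).add (integrable_const (V ij.1 ij.2))).sub (h2 ij)).div_const _
  refine ⟨h3, h4.trans ?_⟩
  congr 1
  refine Finset.sum_congr rfl fun ij _ => ?_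
  have e := integral_sub ((h1 ij).add (integrable_const (V ij.1 ij.2))) (h2 ij)
  simp only [Pi.add_apply] at e
  rw [integral_div, e, integral_add (h1 ij) (integrable_const _), integral_sq_sub_gaussian,
    integral_sq_sub_gaussian]
  simp only [integral_const, probReal_univ, one_smul]
  ring

theorem integral_excessLoss_sample (hm : 1 ≤ m) (hp : 1 ≤ p) (σ : ℝ)
    (N : Matrix (Fin m) (Fin p) ℝ) :
    Integrable (fun x : Fin n → Obs m p =>
      ∫ θ, excessLoss σ N x θ.toMatrix ∂(gaussianProduct u v s G)) (sampleLaw n σ N) ∧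
    ∫ x : Fin n → Obs m p, ∫ θ, excessLoss σ N x θ.toMatrix ∂(gaussianProduct u v s G)
      ∂(sampleLaw n σ N) = n * (((m : ℝ) * p)⁻¹ * ∑ ij : Fin m × Fin p,
        ((N ij.1 ij.2 - ∑ k, u ij.1 k * v ij.2 k) ^ 2 + entryVar u v s ij.1 ij.2) /
          (2 * σ ^ 2)) := by
  have := isProbabilityMeasure_obsLaw hm hp σ N
  obtain ⟨h1, h2⟩ := integral_obsLaw_excess hm hp σ N
    (fun i j => ∑ k, u i k * v j k) (fun i j => entryVar u v s i j)
  simp only [fun x : Fin n → Obs m p => (integral_excessLoss u v s G σ N x).2]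
  have hi := fun l : Fin n => integrable_comp_eval (μ := fun _ : Fin n => obsLaw σ N) (i := l) h1
  refine ⟨integrable_finsetSum _ fun l _ => hi l, ?_⟩
  rw [sampleLaw, integral_finsetSum _ fun l _ => hi l]
  have he := fun l : Fin n => integral_comp_eval (μ := fun _ : Fin n => obsLaw σ N) (i := l) h1.1
  simp only [he, h2, Finset.sum_const, Finset.card_univ, Fintype.card_fin, nsmul_eq_mul]

end Moments

end MatrixVB

end

noncomputable section

namespace MatrixVB

/-! ### Density of the comparison measure with respect to the hierarchical prior, and its logarithm.
-/

section Density

variable {m p K n : ℕ}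

/-- The density of `N(μ, s)` with respect to `N(0, γ)`. -/
def gaussianRatio (μ : ℝ) (s : NNReal) (γ y : ℝ) : ℝ≥0∞ :=
  gaussianPDF μ s y / gaussianPDF 0 γ.toNNReal y

theorem measurable_gaussianRatio (μ : ℝ) (s : NNReal) :
    Measurable fun q : ℝ × ℝ => gaussianRatio μ s q.1 q.2 := by
  unfold gaussianRatio
  have h1 : Measurable fun q : ℝ × ℝ => gaussianPDF 0 q.1.toNNReal q.2 :=
    measurable_uncurry_gaussianPDF.comp (f := fun q : ℝ × ℝ => ((0 : ℝ), q.1.toNNReal, q.2))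
      (by fun_prop)
  exact ((measurable_gaussianPDF μ s).comp measurable_snd).div h1

theorem gaussianReal_eq_withDensity (μ : ℝ) {s : NNReal} (hs : s ≠ 0) {γ : ℝ} (hγ : 0 < γ) :
    gaussianReal μ s =
      (gaussianReal 0 γ.toNNReal).withDensity fun y => gaussianRatio μ s γ y := by
  have hγ' : γ.toNNReal ≠ 0 := by simpa using hγ
  have hm : Measurable fun y => gaussianRatio μ s γ y :=
    (measurable_gaussianRatio μ s).comp (f := fun y => (γ, y)) (by fun_prop)
  rw [gaussianReal_of_var_ne_zero _ hs, gaussianReal_of_var_ne_zero _ hγ',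
    ← withDensity_mul _ (measurable_gaussianPDF _ _) hm]
  congr 1
  funext y
  rw [Pi.mul_apply, gaussianRatio,
    ENNReal.mul_div_cancel (gaussianPDF_pos _ hγ' y).ne' gaussianPDF_ne_top]

/-- For fixed γ, scaling by √γ_k turns the standard Gaussians of the prior into N(0, γ_k); the
product of ratios then changes these to N(u_ik, s_k). -/
theorem lintegral_scaled_rows (u : Fin m → Fin K → ℝ) {s : Fin K → NNReal} (hs : ∀ k, s k ≠ 0)
    {γ : Fin K → ℝ} (hγ : ∀ k, 0 < γ k) {f : (Fin m → Fin K → ℝ) → ℝ≥0∞} (hf : Measurable f) :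
    ∫⁻ ξ, (∏ i, ∏ k, gaussianRatio (u i k) (s k) (γ k) (√(γ k) * ξ i k)) *
      f (fun i k => √(γ k) * ξ i k)
      ∂(Measure.pi fun _ : Fin m => Measure.pi fun _ : Fin K => gaussianReal 0 1) =
    ∫⁻ U, f U ∂(Measure.pi fun i => Measure.pi fun k => gaussianReal (u i k) (s k)) := by
  have hmap : (Measure.pi fun _ : Fin m => Measure.pi fun _ : Fin K => gaussianReal 0 1).map
      (fun ξ i k => √(γ k) * ξ i k) =
      Measure.pi fun _ : Fin m => Measure.pi fun k => gaussianReal 0 (γ k).toNNReal := by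
    have h1 : ∀ k, (gaussianReal 0 1).map (fun y => √(γ k) * y) =
        gaussianReal 0 (γ k).toNNReal := by
      intro k
      rw [gaussianReal_map_const_mul, mul_zero, mul_one]
      congr 1
      ext
      simp [Real.sq_sqrt (hγ k).le, (hγ k).le]
    have hsf1 : ∀ k, SigmaFinite ((gaussianReal 0 1).map fun y => √(γ k) * y) := fun k => by
      rw [h1]; infer_instance
    have h2 : (Measure.pi fun _ : Fin K => gaussianReal 0 1).map
        (fun ξ k => √(γ k) * ξ k) = Measure.pi fun k => gaussianReal 0 (γ k).toNNReal := by
      rw [Measure.pi_map_pi (f := fun k y => √(γ k) * y) fun k => by fun_prop]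
      simp only [h1]
    have hsf2 : ∀ _ : Fin m, SigmaFinite ((Measure.pi fun _ : Fin K => gaussianReal 0 1).map
        fun ξ k => √(γ k) * ξ k) := fun _ => by
      rw [h2]; infer_instance
    rw [Measure.pi_map_pi (f := fun (_ : Fin m) (ξ : Fin K → ℝ) (k : Fin K) => √(γ k) * ξ k)
      fun _ => (measurable_pi_lambda _ fun k => (measurable_pi_apply k).const_mul _).aemeasurable]
    simp only [h2]
  have hr : ∀ (μ : ℝ) (k : Fin K), Measurable fun y => gaussianRatio μ (s k) (γ k) y := fun μ k =>
    (measurable_gaussianRatio μ (s k)).comp (f := fun y => (γ k, y)) (by fun_prop)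
  have hrow : ∀ i, (Measure.pi fun k => gaussianReal (u i k) (s k)) =
      (Measure.pi fun k => gaussianReal 0 (γ k).toNNReal).withDensity
        fun x => ∏ k, gaussianRatio (u i k) (s k) (γ k) (x k) := fun i =>
    pi_withDensity _ _ (fun k y => gaussianRatio (u i k) (s k) (γ k) y) (fun k => hr _ k)
      fun k => gaussianReal_eq_withDensity _ (hs k) (hγ k)
  have hrm : ∀ i, Measurable fun x : Fin K → ℝ =>
      ∏ k, gaussianRatio (u i k) (s k) (γ k) (x k) := fun i =>
    Finset.measurable_prod _ fun k _ => (hr (u i k) k).comp (measurable_pi_apply k)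
  have hall := pi_withDensity (fun _ : Fin m => Measure.pi fun k => gaussianReal 0 (γ k).toNNReal)
    (fun i => Measure.pi fun k => gaussianReal (u i k) (s k))
    (fun i x => ∏ k, gaussianRatio (u i k) (s k) (γ k) (x k)) hrm hrow
  have hRm : Measurable fun U : Fin m → Fin K → ℝ =>
      ∏ i, ∏ k, gaussianRatio (u i k) (s k) (γ k) (U i k) :=
    Finset.measurable_prod _ fun i _ => (hrm i).comp (measurable_pi_apply i)
  rw [hall, lintegral_withDensity_eq_lintegral_mul _ hRm hf, ← hmap,
    lintegral_map (hRm.mul hf) (by fun_prop)]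
  rfl

variable (u : Fin m → Fin K → ℝ) (v : Fin p → Fin K → ℝ) (s : Fin K → NNReal)
  (a b : ℝ) (I : Fin K → Set ℝ)

/-- The density of `gaussianProduct` with respect to the prior. -/
def priorDensity (θ : Param m p K) : ℝ≥0∞ :=
  (∏ i, ∏ k, gaussianRatio (u i k) (s k) (θ.2.2 k) (θ.1 i k)) *
    ((∏ j, ∏ k, gaussianRatio (v j k) (s k) (θ.2.2 k) (θ.2.1 j k)) *
      ∏ k, (I k).indicator (fun _ => (invGammaMeasure a b (I k))⁻¹) (θ.2.2 k))

variable {I}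

theorem measurable_priorDensity (hI : ∀ k, MeasurableSet (I k)) :
    Measurable (priorDensity u v s a b I) := by
  refine Measurable.mul ?_ (Measurable.mul ?_ ?_)
  · exact Finset.measurable_prod _ fun i _ => Finset.measurable_prod _ fun k _ =>
      (measurable_gaussianRatio (u i k) (s k)).comp
        (f := fun θ : Param m p K => (θ.2.2 k, θ.1 i k)) (by fun_prop)
  · exact Finset.measurable_prod _ fun j _ => Finset.measurable_prod _ fun k _ =>
      (measurable_gaussianRatio (v j k) (s k)).comp
        (f := fun θ : Param m p K => (θ.2.2 k, θ.2.1 j k)) (by fun_prop)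
  · exact Finset.measurable_prod _ fun k _ =>
      (measurable_const.indicator (hI k)).comp
        (f := fun θ : Param m p K => θ.2.2 k) (by fun_prop)

theorem cond_eq_withDensity {Ω : Type*} [MeasurableSpace Ω] (μ : Measure Ω) {A : Set Ω}
    (hA : MeasurableSet A) :
    cond μ A = μ.withDensity (A.indicator fun _ => (μ A)⁻¹) := by
  rw [withDensity_indicator hA, withDensity_const]
  rfl

theorem lintegral_scale_first {X Y Z : Type*} [MeasurableSpace X] [MeasurableSpace Y]
    [MeasurableSpace Z] (μ : Measure X) (ν : Measure Y) (τ : Measure Z) [SFinite μ] [SFinite ν]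
    [SFinite τ] {f : X × Y × Z → ℝ≥0∞} (hf : Measurable f) :
    ∫⁻ ω, f ω ∂(μ.prod (ν.prod τ)) = ∫⁻ z, ∫⁻ y, ∫⁻ x, f (x, y, z) ∂μ ∂ν ∂τ := by
  rw [lintegral_prod_symm _ hf.aemeasurable,
    lintegral_prod_symm _ (Measurable.lintegral_prod_left' hf).aemeasurable]

/-- The comparison measure makes U, V and γ independent, whereas the prior does not, so the density
ratio of U and V depends on γ. Integrating over γ last reduces the identity to a Gaussian change of
measure at each fixed γ. -/
theorem gaussianProduct_eq_withDensity {s} (hs : ∀ k, s k ≠ 0) {a b : ℝ} (ha : 0 < a) (hb : 0 < b)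
    (hI : ∀ k, MeasurableSet (I k)) (hI0 : ∀ k, I k ⊆ Set.Ioi 0)
    (hmass : ∀ k, invGammaMeasure a b (I k) ≠ 0) :
    gaussianProduct u v s (fun k => cond (invGammaMeasure a b) (I k)) =
      (prior m p K a b).withDensity (priorDensity u v s a b I) := by
  have := isProbabilityMeasure_gammaMeasure ha hb
  have : IsProbabilityMeasure (invGammaMeasure a b) :=
    Measure.isProbabilityMeasure_map (by fun_prop)
  have hcond : ∀ k, IsProbabilityMeasure (cond (invGammaMeasure a b) (I k)) := fun k =>
    cond_isProbabilityMeasure (hmass k)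
  have hφ := measurable_priorDensity u v s a b hI
  have hD : ∀ k, Measurable ((I k).indicator fun _ => (invGammaMeasure a b (I k))⁻¹) := fun k =>
    measurable_const.indicator (hI k)
  have hG := pi_withDensity (fun _ : Fin K => invGammaMeasure a b)
    (fun k => cond (invGammaMeasure a b) (I k)) _ hD fun k => cond_eq_withDensity _ (hI k)
  refine Measure.ext_of_lintegral _ fun f hf => ?_
  have hT : Measurable fun ω : (Fin m → Fin K → ℝ) × (Fin p → Fin K → ℝ) × (Fin K → ℝ) =>
      ((fun i k => √(ω.2.2 k) * ω.1 i k, fun j k => √(ω.2.2 k) * ω.2.1 j k, ω.2.2) :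
        Param m p K) := by
    fun_prop
  have hDm : Measurable fun γ : Fin K → ℝ =>
      ∏ k, (I k).indicator (fun _ => (invGammaMeasure a b (I k))⁻¹) (γ k) :=
    Finset.measurable_prod _ fun k _ => (hD k).comp (measurable_pi_apply k)
  have hFm : Measurable fun γ : Fin K → ℝ => ∫⁻ V, ∫⁻ U, f (U, V, γ)
      ∂(Measure.pi fun i => Measure.pi fun k => gaussianReal (u i k) (s k))
      ∂(Measure.pi fun j => Measure.pi fun k => gaussianReal (v j k) (s k)) :=
    Measurable.lintegral_prod_left' (f := fun q : (Fin p → Fin K → ℝ) × (Fin K → ℝ) =>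
      ∫⁻ U, f (U, q.1, q.2) ∂(Measure.pi fun i => Measure.pi fun k =>
        gaussianReal (u i k) (s k))) (Measurable.lintegral_prod_left' hf)
  rw [lintegral_withDensity_eq_lintegral_mul _ hφ hf, prior, lintegral_map (hφ.mul hf) hT,
    lintegral_scale_first (f := fun ω : Param m p K => (priorDensity u v s a b I * f)
      (fun i k => √(ω.2.2 k) * ω.1 i k, fun j k => √(ω.2.2 k) * ω.2.1 j k, ω.2.2)) _ _ _
      ((hφ.mul hf).comp hT), gaussianProduct,
    lintegral_scale_first _ _ _ hf, hG, lintegral_withDensity_eq_lintegral_mul _ hDm hFm]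
  refine lintegral_congr fun γ => ?_
  simp only [Pi.mul_apply, priorDensity]
  generalize hDdef : ∏ k, (I k).indicator (fun _ => (invGammaMeasure a b (I k))⁻¹) (γ k) = D
  -- Outside the intervals the density of γ vanishes and both sides are zero; inside, every γ_k is
  -- positive and the Gaussian ratios are legitimate.
  by_cases hγI : ∀ k, γ k ∈ I k
  swap
  · have hD0 : D = 0 := by
      push Not at hγI
      obtain ⟨k, hk⟩ := hγI
      rw [← hDdef]
      exact Finset.prod_eq_zero (Finset.mem_univ k) (Set.indicator_of_notMem hk _)
    simp [hD0]
  have hγ : ∀ k, 0 < γ k := fun k => hI0 k (hγI k)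
  have hDt : D ≠ ⊤ := hDdef ▸ ENNReal.prod_ne_top fun k _ => by
    rw [Set.indicator_of_mem (hγI k)]
    exact ENNReal.inv_ne_top.2 (hmass k)
  have hr : ∀ (μ : ℝ) (k : Fin K), Measurable fun y => gaussianRatio μ (s k) (γ k) y := fun μ k =>
    (measurable_gaussianRatio μ (s k)).comp (f := fun y => (γ k, y)) (by fun_prop)
  have hinner : ∀ ζ : Fin p → Fin K → ℝ, ∫⁻ ξ,
      ((∏ i, ∏ k, gaussianRatio (u i k) (s k) (γ k) (√(γ k) * ξ i k)) *
        ((∏ j, ∏ k, gaussianRatio (v j k) (s k) (γ k) (√(γ k) * ζ j k)) * D)) *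
          f (fun i k => √(γ k) * ξ i k, fun j k => √(γ k) * ζ j k, γ)
        ∂(Measure.pi fun _ : Fin m => Measure.pi fun _ : Fin K => gaussianReal 0 1) =
      D * ((∏ j, ∏ k, gaussianRatio (v j k) (s k) (γ k) (√(γ k) * ζ j k)) *
        ∫⁻ U, f (U, fun j k => √(γ k) * ζ j k, γ)
          ∂(Measure.pi fun i => Measure.pi fun k => gaussianReal (u i k) (s k))) := by
    intro ζ
    have hfζ : Measurable fun U : Fin m → Fin K → ℝ => f (U, fun j k => √(γ k) * ζ j k, γ) :=
      hf.comp (by fun_prop)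
    rw [← lintegral_scaled_rows u hs hγ hfζ, ← mul_assoc, ← lintegral_const_mul]
    · refine lintegral_congr fun ξ => ?_
      ring
    · refine Measurable.mul ?_ (hfζ.comp (by fun_prop))
      exact Finset.measurable_prod _ fun i _ => Finset.measurable_prod _ fun k _ =>
        (hr (u i k) k).comp (f := fun ξ : Fin m → Fin K → ℝ => √(γ k) * ξ i k) (by fun_prop)
  simp only [hinner]
  rw [lintegral_const_mul' _ _ hDt]
  congr 1
  exact (lintegral_scaled_rows v hs hγ (f := fun V => ∫⁻ U, f (U, V, γ)
    ∂(Measure.pi fun i => Measure.pi fun k => gaussianReal (u i k) (s k)))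
    (Measurable.lintegral_prod_left' (f := fun q : (Fin m → Fin K → ℝ) × (Fin p → Fin K → ℝ) =>
      f (q.1, q.2, γ)) (hf.comp (by fun_prop)))).symm

/-- An upper bound for `log (dN(μ, s) / dN(0, γ))` that is uniform over `γ ∈ [lo, hi]`. -/
def logRatioBound (μ : ℝ) (s : NNReal) (lo hi y : ℝ) : ℝ :=
  Real.log (hi / s) / 2 - (y - μ) ^ 2 / (2 * s) + (y - 0) ^ 2 / (2 * lo)

theorem gaussianRatio_toReal_pos (μ : ℝ) {s : NNReal} (hs : s ≠ 0) {γ : ℝ} (hγ : 0 < γ) (y : ℝ) :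
    0 < (gaussianRatio μ s γ y).toReal := by
  have hγ' : γ.toNNReal ≠ 0 := by simpa using hγ
  rw [gaussianRatio, ENNReal.toReal_div, toReal_gaussianPDF, toReal_gaussianPDF]
  exact div_pos (gaussianPDFReal_pos _ _ _ hs) (gaussianPDFReal_pos _ _ _ hγ')

/-- The logarithm contains log(γ/s)/2, increasing in γ, and y²/(2γ), decreasing in γ. Each is
bounded at its own endpoint. -/
theorem log_gaussianRatio_le (μ : ℝ) {s : NNReal} (hs : s ≠ 0) {lo hi γ : ℝ} (hlo : 0 < lo)
    (hγ : γ ∈ Set.Icc lo hi) (y : ℝ) :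
    Real.log (gaussianRatio μ s γ y).toReal ≤ logRatioBound μ s lo hi y := by
  have hγ0 : 0 < γ := hlo.trans_le hγ.1
  have hs0 : (0 : ℝ) < s := by positivity
  have hpi := Real.pi_pos
  have e : (gaussianRatio μ s γ y).toReal =
      √(γ / s) * Real.exp (-(y - μ) ^ 2 / (2 * s) + (y - 0) ^ 2 / (2 * γ)) := by
    rw [gaussianRatio, ENNReal.toReal_div, toReal_gaussianPDF, toReal_gaussianPDF,
      gaussianPDFReal, gaussianPDFReal, Real.coe_toNNReal _ hγ0.le, mul_div_mul_comm,
      ← Real.exp_sub]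
    congr 1
    · rw [inv_div_inv, ← Real.sqrt_div (by positivity)]
      congr 1
      field_simp
    · congr 1
      ring
  rw [e, Real.log_mul (by positivity) (Real.exp_ne_zero _), Real.log_exp,
    Real.log_sqrt (by positivity), logRatioBound]
  have h1 : Real.log (γ / s) ≤ Real.log (hi / s) := by
    apply Real.log_le_log (by positivity)
    gcongr
    exact hγ.2
  have h2 : (y - 0) ^ 2 / (2 * γ) ≤ (y - 0) ^ 2 / (2 * lo) := by
    gcongr
    exact hγ.1
  have h3 : -(y - μ) ^ 2 / (2 * s) = -((y - μ) ^ 2 / (2 * s)) := neg_div _ _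
  rw [h3]
  linarith

theorem integral_logRatioBound (μ : ℝ) {s : NNReal} (hs : s ≠ 0) (lo hi : ℝ) :
    Integrable (logRatioBound μ s lo hi) (gaussianReal μ s) ∧
    ∫ y, logRatioBound μ s lo hi y ∂(gaussianReal μ s) =
      Real.log (hi / s) / 2 - 1 / 2 + (μ ^ 2 + s) / (2 * lo) := by
  have hs0 : (0 : ℝ) < s := by positivity
  have h1 := (integrable_sq_sub_gaussian μ s μ).div_const (2 * (s : ℝ))
  have h2 := (integrable_sq_sub_gaussian μ s 0).div_const (2 * lo)
  have h3 := (integrable_const (Real.log (hi / s) / 2) (μ := gaussianReal μ s)).sub h1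
  refine ⟨h3.add h2, ?_⟩
  have e1 := integral_add h3 h2
  simp only [Pi.sub_apply] at e1
  unfold logRatioBound
  rw [e1, integral_sub (integrable_const _) h1]
  simp only [integral_const, probReal_univ, one_smul, integral_div, integral_sq_sub_gaussian,
    sub_self]
  congr 2
  · field_simp
    ring
  · ring

/-- A uniform upper bound for the logarithm of `priorDensity`. -/
def logDensityBound (u : Fin m → Fin K → ℝ) (v : Fin p → Fin K → ℝ) (s : Fin K → NNReal)
    (a b : ℝ) (lo hi : Fin K → ℝ) (θ : Param m p K) : ℝ :=
  ∑ i, ∑ k, logRatioBound (u i k) (s k) (lo k) (hi k) (θ.1 i k) +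
    (∑ j, ∑ k, logRatioBound (v j k) (s k) (lo k) (hi k) (θ.2.1 j k) +
      ∑ k, -Real.log (invGammaMeasure a b (Set.Icc (lo k) (hi k))).toReal)

theorem log_priorDensity_le {s} (hs : ∀ k, s k ≠ 0) {a b : ℝ} (ha : 0 < a) (hb : 0 < b)
    {lo hi : Fin K → ℝ} (hlo : ∀ k, 0 < lo k)
    (hmass : ∀ k, invGammaMeasure a b (Set.Icc (lo k) (hi k)) ≠ 0)
    {θ : Param m p K} (hθ : ∀ k, θ.2.2 k ∈ Set.Icc (lo k) (hi k)) :
    Real.log (priorDensity u v s a b (fun k => Set.Icc (lo k) (hi k)) θ).toReal ≤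
      logDensityBound u v s a b lo hi θ := by
  have := isProbabilityMeasure_gammaMeasure ha hb
  have : IsProbabilityMeasure (invGammaMeasure a b) :=
    Measure.isProbabilityMeasure_map (by fun_prop)
  have hγ : ∀ k, 0 < θ.2.2 k := fun k => (hlo k).trans_le (hθ k).1
  have hc : ∀ k, 0 < (invGammaMeasure a b (Set.Icc (lo k) (hi k))).toReal := fun k =>
    ENNReal.toReal_pos (hmass k) (measure_ne_top _ _)
  have hU : ∀ i k, 0 < (gaussianRatio (u i k) (s k) (θ.2.2 k) (θ.1 i k)).toReal := fun i k =>
    gaussianRatio_toReal_pos _ (hs k) (hγ k) _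
  have hV : ∀ j k, 0 < (gaussianRatio (v j k) (s k) (θ.2.2 k) (θ.2.1 j k)).toReal := fun j k =>
    gaussianRatio_toReal_pos _ (hs k) (hγ k) _
  have hind : ∀ k, (Set.Icc (lo k) (hi k)).indicator
      (fun _ => (invGammaMeasure a b (Set.Icc (lo k) (hi k)))⁻¹) (θ.2.2 k) =
      (invGammaMeasure a b (Set.Icc (lo k) (hi k)))⁻¹ := fun k => Set.indicator_of_mem (hθ k) _
  simp only [priorDensity, ENNReal.toReal_mul, ENNReal.toReal_prod, hind, ENNReal.toReal_inv]
  rw [Real.log_mul, Real.log_mul, Real.log_prod, Real.log_prod, Real.log_prod, logDensityBound]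
  · refine add_le_add (Finset.sum_le_sum fun i _ => ?_) (add_le_add
      (Finset.sum_le_sum fun j _ => ?_) (Finset.sum_le_sum fun k _ => (Real.log_inv _).le))
    · rw [Real.log_prod fun k _ => (hU i k).ne']
      exact Finset.sum_le_sum fun k _ => log_gaussianRatio_le _ (hs k) (hlo k) (hθ k) _
    · rw [Real.log_prod fun k _ => (hV j k).ne']
      exact Finset.sum_le_sum fun k _ => log_gaussianRatio_le _ (hs k) (hlo k) (hθ k) _
  · exact fun k _ => (inv_pos.2 (hc k)).ne'
  · exact fun j _ => (Finset.prod_pos fun k _ => hV j k).ne'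
  · exact fun i _ => (Finset.prod_pos fun k _ => hU i k).ne'
  · exact (Finset.prod_pos fun j _ => Finset.prod_pos fun k _ => hV j k).ne'
  · exact (Finset.prod_pos fun k _ => inv_pos.2 (hc k)).ne'
  · exact (Finset.prod_pos fun i _ => Finset.prod_pos fun k _ => hU i k).ne'
  · exact (mul_pos (Finset.prod_pos fun j _ => Finset.prod_pos fun k _ => hV j k)
      (Finset.prod_pos fun k _ => inv_pos.2 (hc k))).ne'

theorem integral_logDensityBound {s} (hs : ∀ k, s k ≠ 0) (a b : ℝ) (lo hi : Fin K → ℝ)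
    (G : Fin K → Measure ℝ) [∀ k, IsProbabilityMeasure (G k)] :
    Integrable (logDensityBound u v s a b lo hi) (gaussianProduct u v s G) ∧
    ∫ θ, logDensityBound u v s a b lo hi θ ∂(gaussianProduct u v s G) =
      ∑ i, ∑ k, (Real.log (hi k / s k) / 2 - 1 / 2 + (u i k ^ 2 + s k) / (2 * lo k)) +
        (∑ j, ∑ k, (Real.log (hi k / s k) / 2 - 1 / 2 + (v j k ^ 2 + s k) / (2 * lo k)) +
          ∑ k, -Real.log (invGammaMeasure a b (Set.Icc (lo k) (hi k))).toReal) := by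
  have hU := fun i k => integral_logRatioBound (u i k) (hs k) (lo k) (hi k)
  have hV := fun j k => integral_logRatioBound (v j k) (hs k) (lo k) (hi k)
  have hUi : ∀ i k, Integrable (fun θ : Param m p K =>
      logRatioBound (u i k) (s k) (lo k) (hi k) (θ.1 i k)) (gaussianProduct u v s G) := fun i k => (measurePreserving_left u v s G i k).integrable_comp_of_integrable
    (hU i k).1
  have hVi : ∀ j k, Integrable (fun θ : Param m p K =>
      logRatioBound (v j k) (s k) (lo k) (hi k) (θ.2.1 j k)) (gaussianProduct u v s G) := fun j k => (measurePreserving_right u v s G j k).integrable_comp_of_integrable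
    (hV j k).1
  have hUe : ∀ i k, ∫ θ : Param m p K, logRatioBound (u i k) (s k) (lo k) (hi k) (θ.1 i k)
      ∂(gaussianProduct u v s G) =
      Real.log (hi k / s k) / 2 - 1 / 2 + (u i k ^ 2 + s k) / (2 * lo k) := fun i k => by
    rw [← (hU i k).2, ← (measurePreserving_left u v s G i k).map_eq, integral_map
      (measurePreserving_left u v s G i k).measurable.aemeasurable
      (by unfold logRatioBound; fun_prop)]
  have hVe : ∀ j k, ∫ θ : Param m p K, logRatioBound (v j k) (s k) (lo k) (hi k) (θ.2.1 j k)
      ∂(gaussianProduct u v s G) =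
      Real.log (hi k / s k) / 2 - 1 / 2 + (v j k ^ 2 + s k) / (2 * lo k) := fun j k => by
    rw [← (hV j k).2, ← (measurePreserving_right u v s G j k).map_eq, integral_map
      (measurePreserving_right u v s G j k).measurable.aemeasurable
      (by unfold logRatioBound; fun_prop)]
  have h1 : Integrable (fun θ : Param m p K =>
      ∑ i, ∑ k, logRatioBound (u i k) (s k) (lo k) (hi k) (θ.1 i k)) (gaussianProduct u v s G) :=
    integrable_finsetSum _ fun i _ => integrable_finsetSum _ fun k _ => hUi i k
  have h2 : Integrable (fun θ : Param m p K =>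
      ∑ j, ∑ k, logRatioBound (v j k) (s k) (lo k) (hi k) (θ.2.1 j k))
      (gaussianProduct u v s G) :=
    integrable_finsetSum _ fun j _ => integrable_finsetSum _ fun k _ => hVi j k
  have h3 := h2.add (integrable_const
    (∑ k, -Real.log (invGammaMeasure a b (Set.Icc (lo k) (hi k))).toReal))
  refine ⟨h1.add h3, ?_⟩
  have e := integral_add h1 h3
  simp only [Pi.add_apply] at e
  unfold logDensityBound
  rw [e, integral_add h2 (integrable_const _), integral_finsetSum _ fun i _ =>
    integrable_finsetSum _ fun k _ => hUi i k, integral_finsetSum _ fun j _ =>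
    integrable_finsetSum _ fun k _ => hVi j k]
  simp only [integral_const, probReal_univ, one_smul]
  congr 1
  · refine Finset.sum_congr rfl fun i _ => ?_
    rw [integral_finsetSum _ fun k _ => hUi i k]
    exact Finset.sum_congr rfl fun k _ => hUe i k
  · congr 1
    refine Finset.sum_congr rfl fun j _ => ?_
    rw [integral_finsetSum _ fun k _ => hVi j k]
    exact Finset.sum_congr rfl fun k _ => hVe j k

end Density

end MatrixVB

end

noncomputable section

namespace MatrixVB

/-! ### Prior mass of the scale intervals and the arithmetic of the constants. -/

section Numerics

/-- The Gamma density is bounded below on [1/hi, 1/lo]. Splitting x^(a-1) as x^a · x⁻¹ and bounding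
the factors at opposite ends avoids a case distinction on the sign of a - 1; the length 1/lo - 1/hi
times lo gives 1 - lo/hi. -/
theorem le_invGammaMeasure_Icc {a b lo hi : ℝ} (ha : 0 < a) (hb : 0 < b) (hlo : 0 < lo)
    (hlt : lo < hi) :
    ENNReal.ofReal ((1 - lo / hi) * (b / hi) ^ a * Real.exp (-(b / lo)) / Real.Gamma a) ≤
      invGammaMeasure a b (Set.Icc lo hi) := by
  have hhi : 0 < hi := hlo.trans hlt
  have hΓ := Real.Gamma_pos_of_pos ha
  rw [invGammaMeasure, Measure.map_apply measurable_inv measurableSet_Icc]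
  have hsub : Set.Icc hi⁻¹ lo⁻¹ ⊆ (fun x : ℝ => x⁻¹) ⁻¹' Set.Icc lo hi := by
    intro x hx
    have hx0 : 0 < x := (inv_pos.2 hhi).trans_le hx.1
    exact ⟨(le_inv_comm₀ hlo hx0).2 hx.2, (inv_le_comm₀ hx0 hhi).2 hx.1⟩
  refine le_trans ?_ (measure_mono hsub)
  rw [gammaMeasure, withDensity_apply _ measurableSet_Icc]
  have hconst : ENNReal.ofReal ((1 - lo / hi) * (b / hi) ^ a * Real.exp (-(b / lo)) /
      Real.Gamma a) = ∫⁻ _ in Set.Icc hi⁻¹ lo⁻¹,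
        ENNReal.ofReal (b ^ a / Real.Gamma a * (hi⁻¹ ^ a * lo) * Real.exp (-(b / lo))) := by
    rw [setLIntegral_const, Real.volume_Icc, ← ENNReal.ofReal_mul (by positivity)]
    congr 1
    rw [Real.div_rpow hb.le hhi.le, Real.inv_rpow hhi.le]
    field_simp
  rw [hconst]
  refine setLIntegral_mono' measurableSet_Icc fun x hx => ?_
  have hx0 : 0 < x := (inv_pos.2 hhi).trans_le hx.1
  rw [gammaPDF_of_nonneg hx0.le]
  refine ENNReal.ofReal_le_ofReal ?_
  have h1 : hi⁻¹ ^ a * lo ≤ x ^ (a - 1) := by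
    rw [Real.rpow_sub hx0, Real.rpow_one, div_eq_mul_inv]
    have h2 : hi⁻¹ ^ a ≤ x ^ a := Real.rpow_le_rpow (by positivity) hx.1 ha.le
    have h3 : lo ≤ x⁻¹ := (le_inv_comm₀ hlo hx0).2 hx.2
    gcongr
  have h4 : Real.exp (-(b / lo)) ≤ Real.exp (-(b * x)) := by
    rw [Real.exp_le_exp, neg_le_neg_iff, div_eq_mul_inv]
    exact mul_le_mul_of_nonneg_left hx.2 hb.le
  gcongr

theorem invGammaMeasure_Icc_bounds {a b lo hi : ℝ} (ha : 0 < a) (hb : 0 < b) (hlo : 0 < lo)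
    (hlt : lo < hi) :
    invGammaMeasure a b (Set.Icc lo hi) ≠ 0 ∧
    -Real.log (invGammaMeasure a b (Set.Icc lo hi)).toReal ≤
      -Real.log (1 - lo / hi) + a * Real.log (hi / b) + b / lo + Real.log (Real.Gamma a) ∧
    0 ≤ -Real.log (1 - lo / hi) + a * Real.log (hi / b) + b / lo + Real.log (Real.Gamma a) := by
  have := isProbabilityMeasure_gammaMeasure ha hb
  have : IsProbabilityMeasure (invGammaMeasure a b) :=
    Measure.isProbabilityMeasure_map (by fun_prop)
  have hhi : 0 < hi := hlo.trans hlt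
  have hΓ := Real.Gamma_pos_of_pos ha
  have h := le_invGammaMeasure_Icc ha hb hlo hlt
  have hq : 0 < 1 - lo / hi := by
    rw [sub_pos, div_lt_one hhi]
    exact hlt
  set c := (1 - lo / hi) * (b / hi) ^ a * Real.exp (-(b / lo)) / Real.Gamma a with hc
  have hc0 : 0 < c := by positivity
  have hne : invGammaMeasure a b (Set.Icc lo hi) ≠ 0 :=
    ((ENNReal.ofReal_pos.2 hc0).trans_le h).ne'
  have hle : c ≤ (invGammaMeasure a b (Set.Icc lo hi)).toReal :=
    (ENNReal.ofReal_le_iff_le_toReal (measure_ne_top _ _)).1 h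
  have hle1 : (invGammaMeasure a b (Set.Icc lo hi)).toReal ≤ 1 := measureReal_le_one
  have hlogc : Real.log c = Real.log (1 - lo / hi) - a * Real.log (hi / b) - b / lo -
      Real.log (Real.Gamma a) := by
    rw [hc, Real.log_div (by positivity) hΓ.ne', Real.log_mul (by positivity) (Real.exp_ne_zero _),
      Real.log_mul hq.ne' (by positivity), Real.log_exp, Real.log_rpow (by positivity),
      ← inv_div hi b, Real.log_inv]
    ring
  have h1 := Real.log_le_log hc0 hle
  have h2 := Real.log_nonpos ENNReal.toReal_nonneg hle1
  exact ⟨hne, by linarith, by linarith⟩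

/-- An inverse-gamma probability is at most one; its lower bound on [1/2, 1] with rate 1 is
therefore a lower bound for Γ(a). It serves to show that `constC` is nonnegative. -/
theorem neg_two_sub_log_two_le_log_Gamma {a : ℝ} (ha : 0 < a) :
    -2 - Real.log 2 ≤ Real.log (Real.Gamma a) := by
  have h := (invGammaMeasure_Icc_bounds (b := 1) (lo := 1 / 2) (hi := 1) ha one_pos (by norm_num)
    (by norm_num)).2.2
  have e : -Real.log (1 - 1 / 2 / 1) = Real.log 2 := by
    rw [← Real.log_inv]
    norm_num
  rw [e] at h
  norm_num at h
  linarith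

theorem constC_ge {a : ℝ} (ha : 0 < a) :
    4 * Real.log 2 + 10 * a * Real.log 2 + Real.log (Real.Gamma a) + 3 ≤ constC a := by
  have hΓ := Real.Gamma_pos_of_pos ha
  have hpi : 0 < √Real.pi := Real.sqrt_pos.2 Real.pi_pos
  have h8 : Real.log 8 = 3 * Real.log 2 := by
    rw [show (8 : ℝ) = 2 ^ (3 : ℕ) by norm_num, Real.log_pow]
    norm_num
  have h1 : 0 ≤ Real.log √Real.pi := by
    rw [Real.log_sqrt Real.pi_pos.le]
    exact div_nonneg (Real.log_nonneg (by linarith [Real.pi_gt_three])) (by norm_num)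
  rw [constC, Real.log_mul (by positivity) (by positivity), Real.log_mul (by positivity) hΓ.ne',
    Real.log_mul (by norm_num) hpi.ne', h8, Real.log_rpow (by norm_num)]
  linarith

theorem frobNorm_sq {m p : ℕ} (A : Matrix (Fin m) (Fin p) ℝ) :
    frobNorm A ^ 2 = ∑ i, ∑ j, A i j ^ 2 := by
  rw [frobNorm, Matrix.frobenius_norm_def, ← Real.sqrt_eq_rpow, Real.sq_sqrt (by positivity)]
  simp

theorem frobNorm_nonneg {m p : ℕ} (A : Matrix (Fin m) (Fin p) ℝ) : 0 ≤ frobNorm A := by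
  rw [frobNorm, Matrix.frobenius_norm_def]
  positivity

/-- The relative variance `T⁻¹` used for the active columns. -/
def varScale (n m p K : ℕ) : ℝ := 4 * (n : ℝ) ^ 4 * ((m : ℝ) * p) ^ 3 * K

/-- `A₁` and `A₂` bound the cost of one scale on an active and an inactive column. All costs are
spread over the r(m+p) active entries: `A₁` is halved because m+p ≥ 2, and the K inactive
contributions are halved because K ≤ (m+p)/2. -/
theorem complexity_le {n m p K r : ℕ} (hn : 1 ≤ n) (hm : 1 ≤ m) (hp : 1 ≤ p) (hK : 1 ≤ K)
    (hKm : K ≤ m) (hKp : K ≤ p) (hr : 1 ≤ r) {a A₁ A₂ : ℝ} (ha : 0 < a)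
    (hA₁ : A₁ ≤ Real.log 2 + a * (10 * Real.log 2 + 6 * Real.log ((n : ℝ) * m * p)) + 1 +
      Real.log (Real.Gamma a))
    (hA₂ : A₂ ≤ Real.log ((m : ℝ) + p) + Real.log 2 + 2 + Real.log (Real.Gamma a))
    (hA₁0 : 0 ≤ A₁) (hA₂0 : 0 ≤ A₂) :
    r * (((m : ℝ) + p) * (Real.log (2 * varScale n m p K) / 2 + 1 / 8) + A₁) +
        K * (1 / 2 + A₂) ≤
      2 * (1 + 2 * a) * r * ((m : ℝ) + p) * (Real.log ((n : ℝ) * m * p) + constC a) := by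
  have hn' : (1 : ℝ) ≤ n := by exact_mod_cast hn
  have hm' : (1 : ℝ) ≤ m := by exact_mod_cast hm
  have hp' : (1 : ℝ) ≤ p := by exact_mod_cast hp
  have hK' : (1 : ℝ) ≤ K := by exact_mod_cast hK
  have hKm' : (K : ℝ) ≤ m := by exact_mod_cast hKm
  have hKp' : (K : ℝ) ≤ p := by exact_mod_cast hKp
  have hr' : (1 : ℝ) ≤ r := by exact_mod_cast hr
  have hG := neg_two_sub_log_two_le_log_Gamma ha
  have hC := constC_ge ha
  have hl2 : 0 < Real.log 2 := Real.log_pos (by norm_num)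
  have hmp : (0 : ℝ) < m * p := by positivity
  set G := Real.log (Real.Gamma a)
  set S : ℝ := (m : ℝ) + p with hS
  have hS0 : 0 < S := by positivity
  have hL : Real.log ((n : ℝ) * m * p) = Real.log n + Real.log ((m : ℝ) * p) := by
    rw [mul_assoc, Real.log_mul (by positivity) hmp.ne']
  have hL0 : 0 ≤ Real.log ((n : ℝ) * m * p) := by
    refine Real.log_nonneg ?_
    have := one_le_mul_of_one_le_of_one_le (one_le_mul_of_one_le_of_one_le hn' hm') hp'
    exact this
  have hT : Real.log (2 * varScale n m p K) =
      3 * Real.log 2 + 4 * Real.log n + 3 * Real.log ((m : ℝ) * p) + Real.log K := by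
    have : 2 * varScale n m p K = 2 ^ 3 * (n : ℝ) ^ 4 * ((m : ℝ) * p) ^ 3 * K := by
      rw [varScale]; ring
    rw [this, Real.log_mul (by positivity) (by positivity),
      Real.log_mul (by positivity) (by positivity), Real.log_mul (by positivity) (by positivity),
      Real.log_pow, Real.log_pow, Real.log_pow]
    norm_num
  -- K(m+p) ≤ 2mp, since K is at most both m and p. This absorbs log K from the active variance and
  -- log(m+p) from the inactive scales.
  have hKS : Real.log K + Real.log S ≤ Real.log 2 + Real.log ((m : ℝ) * p) := by
    rw [← Real.log_mul (by positivity) hS0.ne', ← Real.log_mul (by norm_num) hmp.ne']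
    refine Real.log_le_log (by positivity) ?_
    have h1 := mul_le_mul_of_nonneg_right hKm' (by positivity : (0 : ℝ) ≤ p)
    have h2 := mul_le_mul_of_nonneg_left hKp' (by positivity : (0 : ℝ) ≤ m)
    rw [hS]
    nlinarith
  set L := Real.log ((n : ℝ) * m * p)
  have hcol : Real.log (2 * varScale n m p K) / 2 + 1 / 8 + A₁ / 2 + (1 / 2 + A₂) / 2 ≤
      2 * (1 + 2 * a) * (L + constC a) := by
    -- The logarithmic terms add up to 2L + 3aL, and log Γ(a) occurs once, half from `A₁` and half
    -- from `A₂`. Thus `constC`, which also contains it once, dominates the remainder whatever its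
    -- sign.
    have h1 : Real.log (2 * varScale n m p K) / 2 + 1 / 8 + A₁ / 2 + (1 / 2 + A₂) / 2 ≤
        (2 + 3 * a) * L + 3 * Real.log 2 + 5 * a * Real.log 2 + G + 15 / 8 := by
      rw [hT]
      linarith
    have h2 : 0 ≤ constC a := by linarith [mul_pos ha hl2]
    linarith [mul_pos ha hl2, mul_nonneg ha.le h2, mul_nonneg ha.le hL0]
  have h3 : (K : ℝ) * (1 / 2 + A₂) ≤ r * S * ((1 / 2 + A₂) / 2) := by
    have h4 : (K : ℝ) ≤ r * (S / 2) :=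
      (by linarith : (K : ℝ) ≤ S / 2).trans (le_mul_of_one_le_left (by positivity) hr')
    have := mul_le_mul_of_nonneg_right h4 (by positivity : 0 ≤ 1 / 2 + A₂)
    linarith
  have h5 : (r : ℝ) * A₁ ≤ r * S * (A₁ / 2) := by
    have h6 := mul_le_mul_of_nonneg_left (by linarith : 2 ≤ S) (by positivity : 0 ≤ r * (A₁ / 2))
    linarith
  have h7 := mul_le_mul_of_nonneg_left hcol (by positivity : (0 : ℝ) ≤ r * S)
  linarith

theorem complexity_nonneg {n m p : ℕ} (hn : 1 ≤ n) (hm : 1 ≤ m) (hp : 1 ≤ p) (r : ℕ) {a : ℝ}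
    (ha : 0 < a) :
    0 ≤ 2 * (1 + 2 * a) * r * ((m : ℝ) + p) * (Real.log ((n : ℝ) * m * p) + constC a) := by
  have hn' : (1 : ℝ) ≤ n := by exact_mod_cast hn
  have hm' : (1 : ℝ) ≤ m := by exact_mod_cast hm
  have hp' : (1 : ℝ) ≤ p := by exact_mod_cast hp
  have hL : 0 ≤ Real.log ((n : ℝ) * m * p) := Real.log_nonneg
    (one_le_mul_of_one_le_of_one_le (one_le_mul_of_one_le_of_one_le hn' hm') hp')
  have hl2 : 0 < Real.log 2 := Real.log_pos (by norm_num)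
  have hC : 0 ≤ constC a := by
    linarith [constC_ge ha, neg_two_sub_log_two_le_log_Gamma ha, mul_pos ha hl2]
  positivity

/-- Since max(m,p) · K ≤ max(m,p) · min(m,p) = mp, the quotient 2B²/b = 2¹⁰(nmp)⁴(max(m,p)K)² is at
most 2¹⁰(nmp)⁶. The denominator of b also dominates `varScale`, so inactive variances are no larger
than active ones. -/
theorem scale_bounds {n m p K : ℕ} (hn : 1 ≤ n) (hm : 1 ≤ m) (hp : 1 ≤ p) (hK : 1 ≤ K)
    (hKmp : K ≤ min m p) {B b : ℝ} (hB : 0 < B)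
    (hb : b = B ^ 2 / (512 * ((n : ℝ) * m * p) ^ 4 * (((max m p : ℕ) : ℝ) * K) ^ 2)) :
    0 < b ∧ b ≤ B ^ 2 / varScale n m p K ∧ b / B ^ 2 ≤ 1 ∧
      Real.log (2 * B ^ 2 / b) ≤ 10 * Real.log 2 + 6 * Real.log ((n : ℝ) * m * p) ∧
      4 ≤ varScale n m p K := by
  have hn' : (1 : ℝ) ≤ n := by exact_mod_cast hn
  have hm' : (1 : ℝ) ≤ m := by exact_mod_cast hm
  have hp' : (1 : ℝ) ≤ p := by exact_mod_cast hp
  have hK' : (1 : ℝ) ≤ K := by exact_mod_cast hK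
  have hmp1 : (1 : ℝ) ≤ m * p := one_le_mul_of_one_le_of_one_le hm' hp'
  have hx1 : 1 ≤ max m p := hm.trans (le_max_left _ _)
  set x : ℝ := ((max m p : ℕ) : ℝ) with hx
  have hx1' : (1 : ℝ) ≤ x := Nat.one_le_cast.2 hx1
  have hxK : x * K ≤ m * p := by
    have h : max m p * K ≤ m * p := by
      calc max m p * K ≤ max m p * min m p := Nat.mul_le_mul_left _ hKmp
        _ = m * p := max_mul_min m p
    have h' := (Nat.cast_le (α := ℝ)).2 h
    rwa [Nat.cast_mul, Nat.cast_mul] at h'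
  set N : ℝ := (n : ℝ) * m * p with hN
  have hNe : N = n * (m * p) := mul_assoc _ _ _
  have hN1 : 1 ≤ N := hNe ▸ one_le_mul_of_one_le_of_one_le hn' hmp1
  have hmpN : (m : ℝ) * p ≤ N := by rw [hNe]; nlinarith
  have hxK1 : 1 ≤ x * K := one_le_mul_of_one_le_of_one_le hx1' hK'
  have hT4 : 4 ≤ varScale n m p K := by
    have h1 : (1 : ℝ) ≤ (n : ℝ) ^ 4 * ((m : ℝ) * p) ^ 3 * K :=
      one_le_mul_of_one_le_of_one_le
        (one_le_mul_of_one_le_of_one_le (one_le_pow₀ hn') (one_le_pow₀ hmp1)) hK'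
    rw [varScale]
    linarith
  have hD : 0 < 512 * N ^ 4 * (x * K) ^ 2 := by positivity
  have hTD : varScale n m p K ≤ 512 * N ^ 4 * (x * K) ^ 2 := by
    have h1 : (n : ℝ) ^ 4 * ((m : ℝ) * p) ^ 3 ≤ N ^ 4 := by
      rw [hNe, mul_pow (n : ℝ) ((m : ℝ) * p) 4]
      exact mul_le_mul_of_nonneg_left (pow_le_pow_right₀ hmp1 (by norm_num)) (by positivity)
    have h2 : (K : ℝ) ≤ (x * K) ^ 2 := by
      exact (le_mul_of_one_le_left (by positivity) hx1').trans (le_self_pow₀ hxK1 two_ne_zero)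
    have h3 : (n : ℝ) ^ 4 * ((m : ℝ) * p) ^ 3 * K ≤ N ^ 4 * (x * K) ^ 2 :=
      mul_le_mul h1 h2 (by positivity) (by positivity)
    have h4 : 0 ≤ N ^ 4 * (x * K) ^ 2 := by positivity
    rw [varScale]
    linarith
  have hb0 : 0 < b := by rw [hb]; positivity
  refine ⟨hb0, ?_, ?_, ?_, hT4⟩
  · rw [hb]
    exact div_le_div_of_nonneg_left (by positivity) (by linarith) hTD
  · rw [div_le_one (by positivity), hb]
    exact div_le_self (by positivity) (by linarith)
  · have e : 2 * B ^ 2 / b = 2 ^ 10 * N ^ 4 * (x * K) ^ 2 := by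
      rw [hb]
      field_simp
      norm_num
    have h1 : 2 * B ^ 2 / b ≤ 2 ^ 10 * N ^ 6 := by
      have h2 : (x * K) ^ 2 ≤ N ^ 2 := pow_le_pow_left₀ (by positivity) (hxK.trans hmpN) 2
      rw [e, show (2 : ℝ) ^ 10 * N ^ 6 = 2 ^ 10 * N ^ 4 * N ^ 2 by ring]
      gcongr
    refine (Real.log_le_log (by positivity) h1).trans ?_
    rw [Real.log_mul (by positivity) (by positivity), Real.log_pow, Real.log_pow]
    norm_num

end Numerics

end MatrixVB

end

noncomputable section

namespace MatrixVB

/-! ### Choice of variances and scale intervals for a given pair of factors. -/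

section Final

variable {n m p K : ℕ}

/-- `varScale` is calibrated for this: mp entries, each of variance at most 3KB⁴/`varScale`, sum to
3/4 of the stated square. -/
theorem sum_entryVar_le (hm : 1 ≤ m) (hp : 1 ≤ p) (hn : 1 ≤ n) (hK : 1 ≤ K) {B : ℝ} (hB : 0 < B)
    {u : Fin m → Fin K → ℝ} {v : Fin p → Fin K → ℝ} (hu : ∀ i k, |u i k| ≤ B)
    (hv : ∀ j k, |v j k| ≤ B) {s : Fin K → NNReal}
    (hs : ∀ k, (s k : ℝ) ≤ B ^ 2 / varScale n m p K) :
    ∑ ij : Fin m × Fin p, entryVar u v s ij.1 ij.2 ≤ (B ^ 2 / ((n : ℝ) ^ 2 * m * p)) ^ 2 := by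
  have hn' : (1 : ℝ) ≤ n := by exact_mod_cast hn
  have hm' : (1 : ℝ) ≤ m := by exact_mod_cast hm
  have hp' : (1 : ℝ) ≤ p := by exact_mod_cast hp
  have hK' : (1 : ℝ) ≤ K := by exact_mod_cast hK
  set S := B ^ 2 / varScale n m p K with hS
  have hT : 4 ≤ varScale n m p K := by
    have h1 : (1 : ℝ) ≤ (n : ℝ) ^ 4 * ((m : ℝ) * p) ^ 3 * K :=
      one_le_mul_of_one_le_of_one_le (one_le_mul_of_one_le_of_one_le (one_le_pow₀ hn')
        (one_le_pow₀ (one_le_mul_of_one_le_of_one_le hm' hp'))) hK'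
    rw [varScale]
    linarith
  have hS0 : 0 ≤ S := div_nonneg (sq_nonneg B) (by linarith)
  have hSB : S ≤ B ^ 2 := div_le_self (sq_nonneg B) (by linarith)
  have hvar : ∀ i j, entryVar u v s i j ≤ K * (S * (3 * B ^ 2)) := by
    intro i j
    have : ∀ k ∈ (Finset.univ : Finset (Fin K)),
        (s k : ℝ) * (u i k ^ 2 + v j k ^ 2 + s k) ≤ S * (3 * B ^ 2) := by
      intro k _
      have h1 : u i k ^ 2 ≤ B ^ 2 := sq_le_sq' (abs_le.1 (hu i k)).1 (abs_le.1 (hu i k)).2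
      have h2 : v j k ^ 2 ≤ B ^ 2 := sq_le_sq' (abs_le.1 (hv j k)).1 (abs_le.1 (hv j k)).2
      have h3 := hs k
      exact mul_le_mul h3 (by linarith) (by positivity) hS0
    refine (Finset.sum_le_card_nsmul _ _ _ this).trans_eq ?_
    simp
  refine (Finset.sum_le_card_nsmul _ _ _ fun ij _ => hvar ij.1 ij.2).trans ?_
  rw [Finset.card_univ, Fintype.card_prod, Fintype.card_fin, Fintype.card_fin, nsmul_eq_mul,
    Nat.cast_mul, hS, varScale]
  have e : (m : ℝ) * p * (K * (B ^ 2 / (4 * (n : ℝ) ^ 4 * ((m : ℝ) * p) ^ 3 * K) * (3 * B ^ 2))) =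
      3 / 4 * (B ^ 2 / ((n : ℝ) ^ 2 * m * p)) ^ 2 := by
    field_simp
  rw [e]
  linarith [sq_nonneg (B ^ 2 / ((n : ℝ) ^ 2 * m * p))]

theorem frob_add_sum_entryVar_le (hm : 1 ≤ m) (hp : 1 ≤ p) (hn : 1 ≤ n) (hK : 1 ≤ K) {B ε : ℝ}
    (hB : 0 < B) (hε : B ^ 2 / ((n : ℝ) ^ 2 * m * p) ≤ ε) (N : Matrix (Fin m) (Fin p) ℝ)
    {u : Matrix (Fin m) (Fin K) ℝ} {v : Matrix (Fin p) (Fin K) ℝ} (hu : ∀ i k, |u i k| ≤ B)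
    (hv : ∀ j k, |v j k| ≤ B) {s : Fin K → NNReal}
    (hs : ∀ k, (s k : ℝ) ≤ B ^ 2 / varScale n m p K) :
    ∑ ij : Fin m × Fin p,
        ((N ij.1 ij.2 - ∑ k, u ij.1 k * v ij.2 k) ^ 2 + entryVar u v s ij.1 ij.2) ≤
      (frobNorm (N - u * v.transpose) + ε) ^ 2 := by
  have h1 := sum_entryVar_le hm hp hn hK hB hu hv hs
  have h2 : ∑ ij : Fin m × Fin p, (N ij.1 ij.2 - ∑ k, u ij.1 k * v ij.2 k) ^ 2 =
      frobNorm (N - u * v.transpose) ^ 2 := by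
    rw [frobNorm_sq, Fintype.sum_prod_type]
    simp [Matrix.mul_apply]
  have hε0 : 0 ≤ B ^ 2 / ((n : ℝ) ^ 2 * m * p) := by positivity
  have h3 := pow_le_pow_left₀ hε0 hε 2
  have h4 := mul_nonneg (frobNorm_nonneg (N - u * v.transpose)) (hε0.trans hε)
  rw [Finset.sum_add_distrib, h2]
  linarith

theorem sum_column_cost_le (r : ℕ) {cost : Fin K → ℝ} {X Y : ℝ} (hX : 0 ≤ X) (hY : 0 ≤ Y)
    (hact : ∀ k : Fin K, (k : ℕ) < r → cost k ≤ X) (hin : ∀ k : Fin K, ¬(k : ℕ) < r → cost k ≤ Y) :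
    ∑ k, cost k ≤ r * X + K * Y := by
  have h : ∀ k ∈ (Finset.univ : Finset (Fin K)),
      cost k ≤ (if (k : ℕ) < r then X else 0) + Y := by
    intro k _
    -- `Y` is charged to active columns as well, which is harmless as it is nonnegative.
    split_ifs with hk
    · linarith [hact k hk]
    · linarith [hin k hk]
  refine (Finset.sum_le_sum h).trans ?_
  rw [Finset.sum_add_distrib, ← Finset.sum_filter, Finset.sum_const, Finset.sum_const,
    Finset.card_univ, Fintype.card_fin, nsmul_eq_mul, nsmul_eq_mul]
  have hcard : (Finset.univ.filter fun k : Fin K => (k : ℕ) < r).card ≤ r := by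
    rw [Fin.card_filter_val_lt]
    exact min_le_right _ _
  have : ((Finset.univ.filter fun k : Fin K => (k : ℕ) < r).card : ℝ) ≤ r := by
    exact_mod_cast hcard
  gcongr

/-- The Kullback-Leibler cost of `gaussianProduct`, column by column. -/
theorem integral_logDensityBound_le (u : Fin m → Fin K → ℝ) (v : Fin p → Fin K → ℝ)
    {s : Fin K → NNReal} {a b : ℝ} {lo hi e A : Fin K → ℝ}
    (hu : ∀ i k, Real.log (hi k / s k) / 2 - 1 / 2 + (u i k ^ 2 + s k) / (2 * lo k) ≤ e k)
    (hv : ∀ j k, Real.log (hi k / s k) / 2 - 1 / 2 + (v j k ^ 2 + s k) / (2 * lo k) ≤ e k)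
    (hA : ∀ k, -Real.log (invGammaMeasure a b (Set.Icc (lo k) (hi k))).toReal ≤ A k) :
    ∑ i, ∑ k, (Real.log (hi k / s k) / 2 - 1 / 2 + (u i k ^ 2 + s k) / (2 * lo k)) +
        (∑ j, ∑ k, (Real.log (hi k / s k) / 2 - 1 / 2 + (v j k ^ 2 + s k) / (2 * lo k)) +
          ∑ k, -Real.log (invGammaMeasure a b (Set.Icc (lo k) (hi k))).toReal) ≤
      ∑ k, (((m : ℝ) + p) * e k + A k) := by
  have h1 : ∑ i, ∑ k, (Real.log (hi k / s k) / 2 - 1 / 2 + (u i k ^ 2 + s k) / (2 * lo k)) ≤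
      m * ∑ k, e k := by
    refine (Finset.sum_le_card_nsmul _ _ _ fun i _ => Finset.sum_le_sum fun k _ => hu i k).trans_eq
      ?_
    simp
  have h2 : ∑ j, ∑ k, (Real.log (hi k / s k) / 2 - 1 / 2 + (v j k ^ 2 + s k) / (2 * lo k)) ≤
      p * ∑ k, e k := by
    refine (Finset.sum_le_card_nsmul _ _ _ fun j _ => Finset.sum_le_sum fun k _ => hv j k).trans_eq
      ?_
    simp
  have h3 := Finset.sum_le_sum fun k (_ : k ∈ Finset.univ) => hA k
  rw [Finset.sum_add_distrib, ← Finset.mul_sum]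
  linarith

/-- Active columns have a wide scale interval [B², 2B²] and variance B²/T. Inactive columns are
centred at zero with variance b and a scale interval just below b, so that the Gaussian part nearly
matches the prior. -/
theorem exists_good_meanField (hn : 1 ≤ n) (hm : 1 ≤ m) (hp : 1 ≤ p) (hK : 1 ≤ K)
    (hKmp : K ≤ min m p) {a B b : ℝ} (ha : 0 < a) (hB : 0 < B)
    (hb : b = B ^ 2 / (512 * ((n : ℝ) * m * p) ^ 4 * (((max m p : ℕ) : ℝ) * K) ^ 2))
    {r : ℕ} (hr : 1 ≤ r)
    {W : Matrix (Fin m) (Fin K) ℝ × Matrix (Fin p) (Fin K) ℝ} (hW : W ∈ factorPairs m p K r B) :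
    ∃ (s : Fin K → NNReal) (lo hi : Fin K → ℝ), (∀ k, s k ≠ 0) ∧ (∀ k, 0 < lo k) ∧
      (∀ k, invGammaMeasure a b (Set.Icc (lo k) (hi k)) ≠ 0) ∧
      (∀ k, (s k : ℝ) ≤ B ^ 2 / varScale n m p K) ∧
      ∑ i, ∑ k, (Real.log (hi k / s k) / 2 - 1 / 2 + (W.1 i k ^ 2 + s k) / (2 * lo k)) +
        (∑ j, ∑ k, (Real.log (hi k / s k) / 2 - 1 / 2 + (W.2 j k ^ 2 + s k) / (2 * lo k)) +
          ∑ k, -Real.log (invGammaMeasure a b (Set.Icc (lo k) (hi k))).toReal) ≤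
      2 * (1 + 2 * a) * r * ((m : ℝ) + p) * (Real.log ((n : ℝ) * m * p) + constC a) := by
  obtain ⟨hb0, hbT, hbB, hlog, hT4⟩ := scale_bounds hn hm hp hK hKmp hB hb
  obtain ⟨hW1, hW2, hW3, hW4⟩ := hW
  have hm' : (1 : ℝ) ≤ m := by exact_mod_cast hm
  have hp' : (1 : ℝ) ≤ p := by exact_mod_cast hp
  set T := varScale n m p K with hT
  have hT0 : 0 < T := by linarith
  set S : ℝ := (m : ℝ) + p with hS
  have hS2 : 2 ≤ S := by linarith
  have hB2 : 0 < B ^ 2 := by positivity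
  have hl2 : 0 < Real.log 2 := Real.log_pos (by norm_num)
  -- Here b/lo₂ = 1 + 1/S, so an inactive entry costs 1/(2S) and a column of S = m+p entries costs
  -- 1/2. The relative length 1/(S+1) of the interval costs log(S+1) in prior mass.
  set lo₂ := b * (S / (S + 1)) with hlo₂
  have hlo₂0 : 0 < lo₂ := by positivity
  have hlo₂b : lo₂ < b := mul_lt_of_lt_one_right hb0 ((div_lt_one (by positivity)).2 (by linarith))
  obtain ⟨hne₁, hA₁, hA₁0⟩ := invGammaMeasure_Icc_bounds (lo := B ^ 2) (hi := 2 * B ^ 2) ha hb0 hB2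
    (by linarith)
  obtain ⟨hne₂, hA₂, hA₂0⟩ := invGammaMeasure_Icc_bounds (lo := lo₂) (hi := b) ha hb0 hlo₂0 hlo₂b
  set A₁ := -Real.log (1 - B ^ 2 / (2 * B ^ 2)) + a * Real.log (2 * B ^ 2 / b) + b / B ^ 2 +
    Real.log (Real.Gamma a) with hA₁d
  set A₂ := -Real.log (1 - lo₂ / b) + a * Real.log (b / b) + b / lo₂ +
    Real.log (Real.Gamma a) with hA₂d
  have hbound := complexity_le (n := n) (r := r) (A₁ := A₁) (A₂ := A₂) hn hm hp hK
    (hKmp.trans (min_le_left _ _)) (hKmp.trans (min_le_right _ _)) hr ha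
    (by
      have e : -Real.log (1 - B ^ 2 / (2 * B ^ 2)) = Real.log 2 := by
        rw [← Real.log_inv]
        congr 1
        field_simp
        norm_num
      have h := mul_le_mul_of_nonneg_left hlog ha.le
      rw [hA₁d, e]
      linarith)
    (by
      have e : -Real.log (1 - lo₂ / b) = Real.log (S + 1) := by
        rw [← Real.log_inv, hlo₂]
        congr 1
        field_simp
        ring
      have h1 : Real.log (S + 1) ≤ Real.log S + Real.log 2 := by
        rw [← Real.log_mul (by positivity) (by norm_num)]
        exact Real.log_le_log (by positivity) (by linarith)
      have h2 : b / lo₂ ≤ 2 := by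
        rw [hlo₂, div_le_iff₀ (by positivity)]
        have : 1 ≤ 2 * (S / (S + 1)) := by
          rw [← mul_div_assoc, one_le_div (by positivity)]
          linarith
        nlinarith
      rw [hA₂d, e, div_self hb0.ne', Real.log_one]
      linarith)
    hA₁0 hA₂0
  set E := Real.log (2 * T) / 2 + 1 / 8 with hE
  have hE0 : 0 ≤ E := by
    have : 0 ≤ Real.log (2 * T) := Real.log_nonneg (by linarith)
    positivity
  have hent₁ : ∀ y : ℝ, |y| ≤ B →
      Real.log (2 * B ^ 2 / (B ^ 2 / T)) / 2 - 1 / 2 + (y ^ 2 + B ^ 2 / T) / (2 * B ^ 2) ≤ E := by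
    intro y hy
    have h1 : y ^ 2 ≤ B ^ 2 := sq_le_sq' (abs_le.1 hy).1 (abs_le.1 hy).2
    have h2 : B ^ 2 / T ≤ B ^ 2 / 4 := div_le_div_of_nonneg_left hB2.le (by norm_num) hT4
    -- T ≥ 4 gives (1 + 1/4)/2 = 5/8; subtracting 1/2 leaves the 1/8 in `E`.
    have h3 : (y ^ 2 + B ^ 2 / T) / (2 * B ^ 2) ≤ 5 / 8 := by
      rw [div_le_iff₀ (by positivity)]
      linarith
    have h4 : 2 * B ^ 2 / (B ^ 2 / T) = 2 * T := by field_simp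
    rw [h4, hE]
    linarith
  have hent₂ : Real.log (b / b) / 2 - 1 / 2 + ((0 : ℝ) ^ 2 + b) / (2 * lo₂) ≤ 1 / (2 * S) := by
    have h1 : ((0 : ℝ) ^ 2 + b) / (2 * lo₂) = 1 / 2 + 1 / (2 * S) := by
      rw [hlo₂]
      field_simp
      ring
    rw [h1, div_self hb0.ne', Real.log_one]
    linarith
  refine ⟨fun k => if (k : ℕ) < r then (B ^ 2 / T).toNNReal else b.toNNReal,
    fun k => if (k : ℕ) < r then B ^ 2 else lo₂, fun k => if (k : ℕ) < r then 2 * B ^ 2 else b,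
    ?_, ?_, ?_, ?_, ?_⟩
  · intro k
    have : 0 < B ^ 2 / T := by positivity
    dsimp only
    split_ifs
    · simpa using this
    · simpa using hb0
  · intro k
    dsimp only
    split_ifs <;> assumption
  · intro k
    dsimp only
    split_ifs <;> assumption
  · intro k
    have : 0 < B ^ 2 / T := by positivity
    dsimp only
    split_ifs
    · rw [Real.coe_toNNReal _ this.le]
    · rw [Real.coe_toNNReal _ hb0.le]
      exact hbT
  · have hBT : 0 < B ^ 2 / T := by positivity
    refine (integral_logDensityBound_le W.1 W.2 (e := fun k => if (k : ℕ) < r then E else 1 / (2 * S))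
      (A := fun k => if (k : ℕ) < r then A₁ else A₂) ?_ ?_ ?_).trans
      ((sum_column_cost_le r (X := S * E + A₁) (Y := 1 / 2 + A₂) (by positivity) (by positivity)
        ?_ ?_).trans hbound)
    · intro i k
      split_ifs with hk
      · rw [Real.coe_toNNReal _ hBT.le]
        exact hent₁ _ (hW1 i k)
      · rw [Real.coe_toNNReal _ hb0.le, hW3 i k (not_lt.1 hk)]
        exact hent₂
    · intro j k
      split_ifs with hk
      · rw [Real.coe_toNNReal _ hBT.le]
        exact hent₁ _ (hW2 j k)
      · rw [Real.coe_toNNReal _ hb0.le, hW4 j k (not_lt.1 hk)]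
        exact hent₂
    · intro k
      split_ifs <;> assumption
    · intro k hk
      simp only [if_pos hk]
      rfl
    · intro k hk
      simp only [if_neg hk]
      have : S * (1 / (2 * S)) = 1 / 2 := by field_simp
      rw [← hS, this]

end Final

end MatrixVB

end
-- Assembly of the oracle inequality and the comparison measure.
theorem mainTheorem10 (n m p K : ℕ) (hn : 1 ≤ n) (hm : 1 ≤ m) (hp : 1 ≤ p)
    (hK : 1 ≤ K) (hKmp : K ≤ min m p) (a B : ℝ) (ha : 0 < a) (hB : 0 < B) :
    ∃ b : ℝ, 0 < b ∧
      b = B ^ 2 / (512 * ((n : ℝ) * m * p) ^ 4 * (((max m p : ℕ) : ℝ) * K) ^ 2) ∧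
      ∀ (α σ : ℝ), 0 < α → α < 1 → 0 < σ → ∀ (M₀ : Matrix (Fin m) (Fin p) ℝ)
        (vb : Kernel (Fin n → MatrixVB.Obs m p) (MatrixVB.Param m p K)),
        (∀ᵐ x ∂(MatrixVB.sampleLaw n σ M₀), MatrixVB.IsVBApprox α σ a b x (vb x)) →
        ∫⁻ x, ∫⁻ θ, MatrixVB.dist α σ θ.toMatrix M₀ ∂(vb x) ∂(MatrixVB.sampleLaw n σ M₀) ≤
          ⨅ (r : ℕ) (_ : 1 ≤ r ∧ r ≤ K), ⨅ W ∈ MatrixVB.factorPairs m p K r B,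
            ENNReal.ofReal
              (α / (1 - α) *
                  ((MatrixVB.frobNorm (M₀ - W.1 * W.2.transpose) +
                      max (√B / n) (B ^ 2 / ((n : ℝ) ^ 2 * m * p))) ^ 2 /
                    (2 * σ ^ 2 * m * p)) +
                2 * (1 + α) * (1 + 2 * a) * r * ((m : ℝ) + p) *
                    (Real.log ((n : ℝ) * m * p) + MatrixVB.constC a) /
                  (n * (1 - α))) := by
  obtain ⟨hb0, -⟩ := MatrixVB.scale_bounds hn hm hp hK hKmp hB rfl
  refine ⟨_, hb0, rfl, fun α σ hα hα1 hσ M₀ vb hvb => ?_⟩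
  refine le_iInf₂ fun r hr => le_iInf₂ fun W hW => ?_
  obtain ⟨s, lo, hi, hs, hlo, hmass, hsT, hcost⟩ :=
    MatrixVB.exists_good_meanField hn hm hp hK hKmp ha hB rfl hr.1 hW
  obtain ⟨hW1, hW2, -, -⟩ := hW
  set b := B ^ 2 / (512 * ((n : ℝ) * m * p) ^ 4 * (((max m p : ℕ) : ℝ) * K) ^ 2) with hb
  have := isProbabilityMeasure_gammaMeasure ha hb0
  have : IsProbabilityMeasure (MatrixVB.invGammaMeasure a b) :=
    Measure.isProbabilityMeasure_map (by fun_prop)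
  have hG : ∀ k, IsProbabilityMeasure
      (cond (MatrixVB.invGammaMeasure a b) (Set.Icc (lo k) (hi k))) := fun k =>
    cond_isProbabilityMeasure (hmass k)
  have hI : ∀ k, MeasurableSet (Set.Icc (lo k) (hi k)) := fun k => measurableSet_Icc
  -- Diagonal covariances make the rows products of Gaussians, and γ is independent of them, so the
  -- comparison measure is mean-field.
  have hF : MatrixVB.gaussianProduct W.1 W.2 s
      (fun k => cond (MatrixVB.invGammaMeasure a b) (Set.Icc (lo k) (hi k))) ∈
      MatrixVB.meanField m p K :=
    ⟨fun i => ⟨Measure.pi fun k => gaussianReal (W.1 i k) (s k), inferInstance⟩,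
      fun j => ⟨Measure.pi fun k => gaussianReal (W.2 j k) (s k), inferInstance⟩,
      fun k => ⟨_, hG k⟩, rfl⟩
  obtain ⟨hψ, hψe⟩ := MatrixVB.integral_logDensityBound W.1 W.2 hs a b lo hi
    (fun k => cond (MatrixVB.invGammaMeasure a b) (Set.Icc (lo k) (hi k)))
  have hsupp : ∀ᵐ θ ∂(MatrixVB.gaussianProduct W.1 W.2 s
      (fun k => cond (MatrixVB.invGammaMeasure a b) (Set.Icc (lo k) (hi k)))),
      ∀ k, θ.2.2 k ∈ Set.Icc (lo k) (hi k) := by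
    refine ae_all_iff.2 fun k => ?_
    have hk := ae_cond_mem (μ := MatrixVB.invGammaMeasure a b) (hI k)
    exact (MatrixVB.measurePreserving_scale W.1 W.2 s
      (fun k => cond (MatrixVB.invGammaMeasure a b) (Set.Icc (lo k) (hi k)))
      k).quasiMeasurePreserving.ae hk
  obtain ⟨hR, hRe⟩ := MatrixVB.integral_excessLoss_sample (n := n) W.1 W.2 s
    (fun k => cond (MatrixVB.invGammaMeasure a b) (Set.Icc (lo k) (hi k))) hm hp σ M₀
  have hmain := MatrixVB.vb_expected_risk_le hm hp hα hα1 hσ ha hb0 M₀ hF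
    (MatrixVB.measurable_priorDensity W.1 W.2 s a b hI)
    (MatrixVB.gaussianProduct_eq_withDensity W.1 W.2 hs ha hb0 hI
      (fun k y hy => (hlo k).trans_le hy.1) hmass)
    hψ (hsupp.mono fun θ hθ => MatrixVB.log_priorDensity_le W.1 W.2 hs ha hb0 hlo hmass hθ)
    (fun x => (MatrixVB.integral_excessLoss W.1 W.2 s _ σ M₀ x).1) hR hvb
  rw [hψe, hRe] at hmain
  -- Only the second entry of the maximum is needed to dominate the variance.
  have hfrob := MatrixVB.frob_add_sum_entryVar_le (n := n)
    (ε := max (√B / n) (B ^ 2 / ((n : ℝ) ^ 2 * m * p))) hm hp hn hK hB (le_max_right _ _) M₀ hW1 hW2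
    hsT
  have hn' : (1 : ℝ) ≤ n := by exact_mod_cast hn
  have hm' : (1 : ℝ) ≤ m := by exact_mod_cast hm
  have hp' : (1 : ℝ) ≤ p := by exact_mod_cast hp
  have h1α : 0 < 1 - α := by linarith
  have hc : 0 < n * (1 - α) := by positivity
  rw [← ENNReal.mul_le_mul_iff_right (ENNReal.ofReal_pos.2 hc).ne' ENNReal.ofReal_ne_top,
    ← ENNReal.ofReal_mul hc.le]
  refine hmain.trans (ENNReal.ofReal_le_ofReal ?_)
  rw [← Finset.sum_div]
  set Q := ∑ ij : Fin m × Fin p, ((M₀ ij.1 ij.2 - ∑ k, W.1 ij.1 k * W.2 ij.2 k) ^ 2 +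
    MatrixVB.entryVar W.1 W.2 s ij.1 ij.2)
  set F := (MatrixVB.frobNorm (M₀ - W.1 * W.2.transpose) +
    max (√B / n) (B ^ 2 / ((n : ℝ) ^ 2 * m * p))) ^ 2
  have hX := MatrixVB.complexity_nonneg hn hm hp r ha
  have hrisk : α * (n * (((m : ℝ) * p)⁻¹ * (Q / (2 * σ ^ 2)))) ≤
      α * (n * (((m : ℝ) * p)⁻¹ * (F / (2 * σ ^ 2)))) := by
    gcongr
  have e : n * (1 - α) * (α / (1 - α) * (F / (2 * σ ^ 2 * m * p)) +
      2 * (1 + α) * (1 + 2 * a) * r * ((m : ℝ) + p) *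
        (Real.log ((n : ℝ) * m * p) + MatrixVB.constC a) / (n * (1 - α))) =
      α * (n * (((m : ℝ) * p)⁻¹ * (F / (2 * σ ^ 2)))) + (1 + α) * (2 * (1 + 2 * a) * r *
        ((m : ℝ) + p) * (Real.log ((n : ℝ) * m * p) + MatrixVB.constC a)) := by
    field_simp
  rw [e]
  -- The argument yields the complexity term with factor 1; the factor 1 + α exceeds it by a
  -- nonnegative amount.
  linarith [mul_nonneg hα.le hX]
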